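/- Let $S$ be a closed topological surface (a compact Hausdorff $2$-manifold without boundary), let $P\subset S$ be a finite set of $n\ge 0$ points, and suppose that the surface of finite type $\Sigma=S\smallsetminus P$ is connected, orientable and hyperbolic, i.e. that its Euler characteristic $\chi(\Sigma)=2-2g-n$ is negative, where $g$ is the genus of $S$ (so that $2g$ is the rank of $H_1(S;\mathbb{Z})$). Fix an orientation of $\Sigma$ and a base point, and let $\mathrm{Mod}(\Sigma)=\pi_0(\mathrm{Homeo}^+(\Sigma))$ be the mapping class group, i.e. the group of isotopy classes of orientation-preserving homeomorphisms of $\Sigma$, together with its natural homomorphism $\mathrm{Mod}(\Sigma)\to\mathrm{Out}(\pi_1(\Sigma))$. Let $\mathrm{PMod}(\Sigma)\le\mathrm{Mod}(\Sigma)$ be the pure mapping class group, i.e. the kernel of the action of $\mathrm{Mod}(\Sigma)$ on the set $P$ of punctures. Then $\mathrm{PMod}(\Sigma)$ is a congruence subgroup of $\mathrm{Mod}(\Sigma)$: there is a characteristic subgroup $K$ of finite index in $\pi_1(\Sigma)$ such that the kernel of the composite $$\mathrm{Mod}(\Sigma)\to\mathrm{Out}(\pi_1(\Sigma))\to\mathrm{Out}(\pi_1(\Sigma)/K)$$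 is contained in $\mathrm{PMod}(\Sigma)$. -/

import Mathlib

open Set Filter Topology CategoryTheory
open scoped unitInterval

noncomputable section

/-! ### Outer automorphisms and congruence subgroups -/

section Group

instance innNormal (G : Type*) [Group G] : (MulAut.conj : G →* MulAut G).range.Normal where
  conj_mem := by
    rintro _ ⟨g, rfl⟩ φ
    refine ⟨φ g, ?_⟩
    ext x
    simp [MulAut.conj_apply]

/-- The outer automorphism group `Out(G) = Aut(G) / Inn(G)`. -/
abbrev Out (G : Type*) [Group G] : Type _ :=
  MulAut G ⧸ (MulAut.conj : G →* MulAut G).range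

variable {G : Type*} [Group G]

/-- The homomorphism `Aut(G) → Aut(G / K)` for a characteristic subgroup `K`. -/
def autQuotient (K : Subgroup G) [K.Characteristic] : MulAut G →* MulAut (G ⧸ K) where
  toFun φ := QuotientGroup.congr K K φ (Subgroup.characteristic_iff_map_eq.mp ‹_› φ)
  map_one' := by
    ext x
    induction x using QuotientGroup.induction_on
    rfl
  map_mul' φ ψ := by
    ext x
    induction x using QuotientGroup.induction_on
    rfl

/-- The natural homomorphism `Out(G) → Out(G / K)` for a characteristic subgroup `K`. -/
def outQuotient (K : Subgroup G) [K.Characteristic] : Out G →* Out (G ⧸ K) :=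
  QuotientGroup.map _ _ (autQuotient K) (by
    rintro _ ⟨g, rfl⟩
    refine ⟨(g : G ⧸ K), ?_⟩
    ext x
    induction x using QuotientGroup.induction_on
    rfl)

/-- The principal congruence subgroup of `Δ` (acting on `G` by outer automorphisms through `ρ`)
defined by the characteristic quotient `G / K`: the kernel of `Δ → Out(G) → Out(G / K)`. -/
def principalCongruenceSubgroup {Δ : Type*} [Group Δ] (ρ : Δ →* Out G)
    (K : Subgroup G) [K.Characteristic] : Subgroup Δ :=
  ((outQuotient K).comp ρ).ker

/-- A subgroup of `Δ` is a congruence subgroup if it contains the principal congruence subgroup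
defined by some finite characteristic quotient of `G`. -/
def IsCongruenceSubgroup {Δ : Type*} [Group Δ] (ρ : Δ →* Out G) (Γ : Subgroup Δ) : Prop :=
  ∃ (K : Subgroup G) (_ : K.Characteristic),
    K.FiniteIndex ∧ principalCongruenceSubgroup ρ K ≤ Γ

end Group

/-! ### Orientations of topological surfaces -/

section Orientation

/-- A map `g`, defined and injective near `z`, preserves the orientation of the plane at `z`:
the images under `g` of small positively oriented circles about `z` have winding number `+1` about
`g z`. Here `θ` is a continuous choice of the argument of `g - g z` along the circle. -/
def PreservesOrientationAt (g : ℂ → ℂ) (z : ℂ) : Prop :=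
  ∀ᶠ r : ℝ in 𝓝[>] 0, ∃ θ : ℝ → ℝ, ContinuousOn θ (Icc 0 (2 * Real.pi)) ∧
    θ (2 * Real.pi) = θ 0 + 2 * Real.pi ∧
    ∀ t ∈ Icc 0 (2 * Real.pi), g (circleMap z r t) - g z =
      (‖g (circleMap z r t) - g z‖ : ℂ) * Complex.exp (θ t * Complex.I)

/-- Two topological charts of a surface, with values in the plane `ℂ = ℝ²`, are compatibly oriented
if the transition map preserves the orientation at each point where it is defined. -/
def OrientationCompatible {X : Type*} [TopologicalSpace X] (c d : OpenPartialHomeomorph X ℂ) :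
    Prop :=
  ∀ x ∈ c.source ∩ d.source, PreservesOrientationAt (fun z => d (c.symm z)) (c x)

/-- An orientation of a topological surface: a maximal oriented atlas. No smoothness (and nothing
holomorphic) is involved; `ℂ` is only the plane. -/
structure SurfaceOrientation (X : Type*) [TopologicalSpace X] where
  /-- the positively oriented charts -/
  charts : Set (OpenPartialHomeomorph X ℂ)
  covers : ∀ x, ∃ c ∈ charts, x ∈ c.source
  compatible : ∀ c ∈ charts, ∀ d ∈ charts, OrientationCompatible c d
  maximal : ∀ d, (∀ c ∈ charts, OrientationCompatible c d) → d ∈ charts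

variable {X : Type*} [TopologicalSpace X]

/-- The group `Homeo⁺(X)` of homeomorphisms `f` of `X` that preserve the orientation: a chart `c` is
positively oriented if and only if `c ∘ f` is. -/
def homeoPlus (o : SurfaceOrientation X) : Subgroup (X ≃ₜ X) where
  carrier := {f | ∀ c, f.transOpenPartialHomeomorph c ∈ o.charts ↔ c ∈ o.charts}
  one_mem' c := by
    have : (1 : X ≃ₜ X).transOpenPartialHomeomorph c = c := by
      ext <;> rfl
    rw [this]
  mul_mem' {f g} hf hg c := by
    have : (f * g).transOpenPartialHomeomorph c =
        g.transOpenPartialHomeomorph (f.transOpenPartialHomeomorph c) :=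
      Homeomorph.trans_transOpenPartialHomeomorph g f c
    rw [this, hg, hf]
  inv_mem' {f} hf c := by
    rw [← hf]
    have : f.transOpenPartialHomeomorph (f⁻¹.transOpenPartialHomeomorph c) = c := by
      rw [← Homeomorph.trans_transOpenPartialHomeomorph]
      have h : f.trans f⁻¹ = 1 := inv_mul_cancel f
      rw [h]
      ext <;> rfl
    rw [this]

end Orientation

/-! ### The mapping class group -/

section MappingClassGroup

variable {X : Type*} [TopologicalSpace X]

/-- `f` is isotopic to the identity: there is a continuous family of homeomorphisms of `X` from the
identity to `f`. -/
def IsotopicToId (f : X ≃ₜ X) : Prop :=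
  ∃ H : C(I × X, X), (∀ t, IsHomeomorph fun x => H (t, x)) ∧
    (∀ x, H (0, x) = x) ∧ ∀ x, H (1, x) = f x

/-- The subgroup of `Homeo⁺(X)` of homeomorphisms isotopic to the identity. -/
def isotopySubgroup (o : SurfaceOrientation X) : Subgroup (homeoPlus o) where
  carrier := {f | IsotopicToId (f : X ≃ₜ X)}
  one_mem' := ⟨⟨Prod.snd, continuous_snd⟩, fun _ => IsHomeomorph.id, fun _ => rfl, fun _ => rfl⟩
  mul_mem' := by
    rintro ⟨f, _⟩ ⟨g, _⟩ ⟨H, hH, H0, H1⟩ ⟨K, hK, K0, K1⟩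
    refine ⟨⟨fun p => H (p.1, K p), by fun_prop⟩, fun t => (hH t).comp (hK t), fun x => ?_,
      fun x => ?_⟩
    · simp [K0, H0]
    · simp [K1, H1]
  inv_mem' := by
    rintro ⟨f, _⟩ ⟨H, hH, H0, H1⟩
    refine ⟨⟨fun p => f.symm (H (σ p.1, p.2)), by fun_prop⟩,
      fun t => f.symm.isHomeomorph.comp (hH (σ t)), fun x => ?_, fun x => ?_⟩
    · simp at H1
      simp [H1]
    · simp [H0]

instance isotopySubgroup_normal (o : SurfaceOrientation X) : (isotopySubgroup o).Normal where
  conj_mem := by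
    rintro ⟨f, _⟩ ⟨H, hH, H0, H1⟩ ⟨g, _⟩
    refine ⟨⟨fun p => g (H (p.1, g.symm p.2)), by fun_prop⟩,
      fun t => g.isHomeomorph.comp ((hH t).comp g.symm.isHomeomorph), fun x => ?_, fun x => ?_⟩
    · simp [H0]
    · simp at H1
      simp [H1]

/-- The mapping class group `Mod(X) = π₀(Homeo⁺(X))` of an oriented surface: orientation-preserving
homeomorphisms up to isotopy. -/
abbrev MappingClassGroup (o : SurfaceOrientation X) : Type _ :=
  homeoPlus o ⧸ isotopySubgroup o

end MappingClassGroup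

/-! ### The outer action on the fundamental group -/

section OuterAction

variable {X : Type*} [TopologicalSpace X]

/-- The equivalence of fundamental groupoids induced by a homeomorphism. -/
def groupoidEquiv (f : X ≃ₜ X) : FundamentalGroupoid X ≌ FundamentalGroupoid X :=
  CategoryTheory.Equivalence.mk (FundamentalGroupoid.map (f : C(X, X)))
    (FundamentalGroupoid.map (f.symm : C(X, X)))
    (eqToIso (by
      rw [← FundamentalGroupoid.map_comp, ← FundamentalGroupoid.map_id]
      congr 1; ext x; simp))
    (eqToIso (by
      rw [← FundamentalGroupoid.map_comp, ← FundamentalGroupoid.map_id]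
      congr 1; ext x; simp))

/-- The automorphism `[α] ↦ [γ · f(α) · γ⁻¹]` of `π₁(X, x₀)` determined by a homeomorphism `f` and a
homotopy class `γ` of paths from `x₀` to `f x₀`. -/
def pushAut (f : X ≃ₜ X) {x₀ : X}
    (γ : FundamentalGroupoid.mk x₀ ⟶ FundamentalGroupoid.mk (f x₀)) :
    MulAut (FundamentalGroup X x₀) :=
  ((groupoidEquiv f).fullyFaithfulFunctor.mulEquivEnd (FundamentalGroupoid.mk x₀)).trans
    ((Groupoid.isoEquivHom _ _).symm γ).symm.conj

theorem pushAut_apply (f : X ≃ₜ X) {x₀ : X}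
    (γ : FundamentalGroupoid.mk x₀ ⟶ FundamentalGroupoid.mk (f x₀))
    (α : FundamentalGroup X x₀) :
    pushAut f γ α = γ ≫ (FundamentalGroupoid.map (f : C(X, X))).map α ≫ Groupoid.inv γ :=
  rfl

theorem groupoid_conj_change {C : Type*} [Groupoid C] {a b : C} (γ γ' : a ⟶ b) (β : b ⟶ b) :
    γ ≫ β ≫ Groupoid.inv γ =
      (γ ≫ Groupoid.inv γ') ≫ (γ' ≫ β ≫ Groupoid.inv γ') ≫ (γ' ≫ Groupoid.inv γ) := by
  simp

theorem groupoid_conj_comp {C : Type*} [Groupoid C] (F : C ⥤ C) {a b : C} (γ : a ⟶ F.obj a)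
    (δ : a ⟶ b) (β : b ⟶ b) :
    (γ ≫ F.map δ) ≫ F.map β ≫ Groupoid.inv (γ ≫ F.map δ) =
      γ ≫ F.map (δ ≫ β ≫ Groupoid.inv δ) ≫ Groupoid.inv γ := by
  simp

theorem groupoid_conj_natural {C : Type*} [Groupoid C] {a b : C} (γ : a ⟶ b) (α : a ⟶ a)
    (β : b ⟶ b) (h : α ≫ γ = γ ≫ β) : γ ≫ β ≫ Groupoid.inv γ = α := by
  rw [← Category.assoc, ← h]
  simp

theorem mk_pushAut_eq (f : X ≃ₜ X) {x₀ : X}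
    (γ γ' : FundamentalGroupoid.mk x₀ ⟶ FundamentalGroupoid.mk (f x₀)) :
    (QuotientGroup.mk (pushAut f γ) : Out (FundamentalGroup X x₀)) =
      QuotientGroup.mk (pushAut f γ') := by
  rw [eq_comm, QuotientGroup.eq]
  let g : FundamentalGroup X x₀ := γ' ≫ Groupoid.inv γ
  have hg : g⁻¹ = γ ≫ Groupoid.inv γ' :=
    inv_eq_of_mul_eq_one_left (by simp [g, End.mul_def, End.one_def])
  have key : pushAut f γ = MulAut.conj g * pushAut f γ' := by
    ext α
    rw [MulAut.mul_apply, MulAut.conj_apply, hg]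
    exact groupoid_conj_change γ γ' _
  rw [key, ← mul_assoc]
  simpa using (innNormal (FundamentalGroup X x₀)).conj_mem _ ⟨g, rfl⟩ (pushAut f γ')⁻¹

theorem pushAut_mul (f g : X ≃ₜ X) {x₀ : X}
    (γ : FundamentalGroupoid.mk x₀ ⟶ FundamentalGroupoid.mk (f x₀))
    (δ : FundamentalGroupoid.mk x₀ ⟶ FundamentalGroupoid.mk (g x₀)) :
    pushAut (f * g) (γ ≫ (FundamentalGroupoid.map (f : C(X, X))).map δ) =
      pushAut f γ * pushAut g δ := by
  ext α
  have h : (FundamentalGroupoid.map ((f * g : X ≃ₜ X) : C(X, X))).map α =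
      (FundamentalGroupoid.map (f : C(X, X))).map
        ((FundamentalGroupoid.map (g : C(X, X))).map α) := by
    obtain ⟨a, rfl⟩ := Path.Homotopic.Quotient.mk_surjective α
    rfl
  rw [MulAut.mul_apply, pushAut_apply, pushAut_apply, pushAut_apply, h]
  exact groupoid_conj_comp (FundamentalGroupoid.map (f : C(X, X))) γ δ _

theorem pushAut_isotopicToId (f : X ≃ₜ X) (x₀ : X) (hf : IsotopicToId f) :
    ∃ γ : FundamentalGroupoid.mk x₀ ⟶ FundamentalGroupoid.mk (f x₀), pushAut f γ = 1 := by
  obtain ⟨H, -, H0, H1⟩ := hf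
  let F : ContinuousMap.Homotopy (ContinuousMap.id X) (f : C(X, X)) := ⟨H, H0, H1⟩
  let η := FundamentalGroupoidFunctor.homotopicMapsNatIso F
  refine ⟨η.app ⟨x₀⟩, ?_⟩
  ext α
  have h := η.naturality (X := ⟨x₀⟩) (Y := ⟨x₀⟩) α
  have h' : (FundamentalGroupoid.map (ContinuousMap.id X)).map α = α := by
    obtain ⟨a, rfl⟩ := Path.Homotopic.Quotient.mk_surjective α
    rfl
  rw [h'] at h
  exact groupoid_conj_natural (C := FundamentalGroupoid X) (a := ⟨x₀⟩) (b := ⟨f x₀⟩) _ α _ h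

variable [PathConnectedSpace X]

/-- The natural homomorphism `Homeo(X) → Out(π₁(X, x₀))`. It sends `f` to the class of
`[α] ↦ [γ · f(α) · γ⁻¹]`, where the choice of the path `γ` from `x₀` to `f x₀` does not matter. -/
def homeoOuterAction (x₀ : X) : (X ≃ₜ X) →* Out (FundamentalGroup X x₀) :=
  MonoidHom.mk' (fun f => QuotientGroup.mk (pushAut f
    (FundamentalGroupoid.fromPath (.mk (PathConnectedSpace.somePath x₀ (f x₀)))))) (by
      intro f g
      rw [← QuotientGroup.mk_mul, ← pushAut_mul]
      exact mk_pushAut_eq _ _ _)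

/-- The natural homomorphism `Mod(X) → Out(π₁(X, x₀))`. -/
def outerAction (o : SurfaceOrientation X) (x₀ : X) :
    MappingClassGroup o →* Out (FundamentalGroup X x₀) :=
  QuotientGroup.lift (isotopySubgroup o) ((homeoOuterAction x₀).comp (homeoPlus o).subtype) (by
    rintro ⟨f, _⟩ hf
    obtain ⟨γ, hγ⟩ := pushAut_isotopicToId f x₀ hf
    refine (mk_pushAut_eq f _ γ).trans ?_
    rw [hγ]
    rfl)

end OuterAction

/-! ### Surfaces of finite type -/

section FiniteType

/-- The surface obtained from a closed surface `S` by deleting the finite set `P` of points. -/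
abbrev Punctured (S : Type*) (P : Finset S) : Type _ := {x : S // x ∉ P}

variable {S : Type*} [TopologicalSpace S]

instance punctured_pathConnectedSpace [T1Space S] [ChartedSpace ℂ S] (P : Finset S)
    [ConnectedSpace (Punctured S P)] : PathConnectedSpace (Punctured S P) := by
  have : LocallyPathConnectedSpace S := ChartedSpace.locallyPathConnectedSpace ℂ S
  have ho : IsOpen {x : S | x ∉ P} := P.finite_toSet.isClosed.isOpen_compl
  have : LocallyPathConnectedSpace (Punctured S P) := ho.locallyPathConnectedSpace
  exact PathConnectedSpace.of_locallyPathConnectedSpace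

/-- The first Betti number of `S`, i.e. the rank of `H₁(S; ℤ)`, the abelianization of
`π₁(S, x)`. For a closed connected orientable surface of genus `g` it equals `2g`. -/
def firstBetti (S : Type*) [TopologicalSpace S] (x : S) : ℕ :=
  Module.finrank ℤ (Additive (Abelianization (FundamentalGroup S x)))

/-- The Euler characteristic `2 - 2g - n` of a closed connected orientable surface `S` with a set
`P` of `n` points deleted. (The base point `x` serves only to compute `2g`.) -/
def eulerCharPunctured (P : Finset S) (x : S) : ℤ :=
  2 - (firstBetti S x : ℤ) - (P.card : ℤ)

/-- The trace on `S ∖ P` of the filter of neighbourhoods of the puncture `p`. -/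
def punctureFilter (P : Finset S) (p : S) : Filter (Punctured S P) :=
  comap Subtype.val (𝓝 p)

/-- The orientation-preserving homeomorphisms of `S ∖ P` that fix each puncture: `f x` tends to `p`
if and only if `x` does. -/
def homeoFixingPunctures (P : Finset S) (o : SurfaceOrientation (Punctured S P)) :
    Subgroup (homeoPlus o) where
  carrier := {f | ∀ p ∈ P, map (f : Punctured S P ≃ₜ Punctured S P) (punctureFilter P p) =
    punctureFilter P p}
  one_mem' _ _ := map_id
  mul_mem' {f g} hf hg p hp := by
    have h : map ((f * g : homeoPlus o) : Punctured S P ≃ₜ Punctured S P) (punctureFilter P p) =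
      map (f : Punctured S P ≃ₜ Punctured S P) (map (g : Punctured S P ≃ₜ Punctured S P)
        (punctureFilter P p)) := (map_map).symm
    rw [h, hg p hp, hf p hp]
  inv_mem' {f} hf p hp := by
    have h : map ((f⁻¹ : homeoPlus o) : Punctured S P ≃ₜ Punctured S P)
        (map (f : Punctured S P ≃ₜ Punctured S P) (punctureFilter P p)) = punctureFilter P p := by
      rw [map_map]
      convert map_id
      ext x
      simp
    rwa [hf p hp] at h

/-- The pure mapping class group `PMod(S ∖ P)`: the mapping classes that act trivially on the set of
punctures. Isotopic homeomorphisms induce the same permutation of the punctures, so one representative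
of a class fixes every puncture if and only if all of them do. -/
def pureMappingClassGroup (P : Finset S) (o : SurfaceOrientation (Punctured S P)) :
    Subgroup (MappingClassGroup o) :=
  (homeoFixingPunctures P o).map (QuotientGroup.mk' (isotopySubgroup o))

end FiniteType

end

noncomputable section

/-! ### Continuous logarithms and winding numbers -/

section Winding

/-! Let `f` be an orientation-preserving homeomorphism that carries a puncture `p` to a different
puncture `q`. Some chart `c` onto the plane has both in its domain (`exists_chart_of_pair`), and `(c
- c p) / (c - c q)`, extended by `1`, is continuous and nowhere zero on the punctured surface. Its
winding number along loops is a homomorphism `φ` from the fundamental group to ℤ. A small circle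
about `p`, positive in `c`, has value `1`. Its image under `f` runs close to `q` and, since
orientation is preserved, turns once positively about `c q`; as `c q` belongs to the denominator,
the value is `-1` (`exists_windingHom`). So `f` changes `φ` modulo 3.

Let `K` be the common kernel of all homomorphisms to ℤ/3. It is characteristic, and it has finite
index because the fundamental group is finitely generated (`fundamentalGroup_punctured_fg`). An
automorphism that is inner modulo `K` preserves every homomorphism to ℤ/3
(`map_eq_of_outQuotient_eq_one`), so a mapping class acting trivially on the quotient by `K` in the
outer sense moves no puncture.

Two ingredients need work. Orientation is expressed by winding numbers in charts: the local degree
is locally constant and multiplicative, so `f` has degree one in every connected chart, and then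
also at a puncture once the missing value is filled in (`hasLocalDegree_update`). Finite generation
comes from a van Kampen argument for a finite cover by discs with at most one puncture each
(`PathCocycle.group_fg_of_cover`). -/

theorem IsPreconnected.exists_int_of_exp_eq {Y : Type*} [TopologicalSpace Y] {s : Set Y}
    (hs : IsPreconnected s) {F G : Y → ℂ} (hF : ContinuousOn F s) (hG : ContinuousOn G s)
    (h : ∀ y ∈ s, Complex.exp (F y) = Complex.exp (G y)) :
    ∃ n : ℤ, ∀ y ∈ s, F y = G y + n * (2 * Real.pi * Complex.I) := by
  rcases s.eq_empty_or_nonempty with rfl | ⟨x, hx⟩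
  · exact ⟨0, by simp⟩
  obtain ⟨n, hn⟩ := Complex.exp_eq_exp_iff_exists_int.mp (h x hx)
  refine ⟨n, fun y hy => ?_⟩
  have hT : DiscreteTopology (AddSubgroup.zmultiples (2 * Real.pi * Complex.I : ℂ)) :=
    NormedSpace.discreteTopology_zmultiples _
  -- The difference takes values in the discrete group `2πiℤ`, hence is constant on a preconnected
  -- set.
  have hm : MapsTo (fun y => F y - G y) s
      (AddSubgroup.zmultiples (2 * Real.pi * Complex.I : ℂ) : Set ℂ) := by
    intro z hz
    obtain ⟨m, hm⟩ := Complex.exp_eq_exp_iff_exists_int.mp (h z hz)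
    exact ⟨m, by simp [hm]⟩
  have := hs.constant_of_mapsTo (T := (AddSubgroup.zmultiples (2 * Real.pi * Complex.I : ℂ) : Set ℂ))
    ⟨hT⟩ (hF.sub hG) hm hy hx
  simp only [Pi.sub_apply, hn] at this
  linear_combination this

/-- Applied to a convex parameter space of loops, one logarithm for the whole family shows that all
its members have the same winding number; this takes the place of homotopy invariance. -/
theorem Convex.exists_continuousOn_log {E : Type*} [NormedAddCommGroup E] [NormedSpace ℝ E]
    {U : Set E} (hU : Convex ℝ U) (hne : U.Nonempty) (ho : IsOpen U) {g : E → ℂ}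
    (hg : ContinuousOn g U) (h0 : ∀ x ∈ U, g x ≠ 0) :
    ∃ L : E → ℂ, ContinuousOn L U ∧ ∀ x ∈ U, Complex.exp (L x) = g x := by
  have : ContractibleSpace U := hU.contractibleSpace hne
  have hs : IsSimplyConnected U := inferInstanceAs (SimplyConnectedSpace U)
  obtain ⟨f, hf, he⟩ := Complex.exists_continuousOn_eqOn_exp_comp hs ho hg (by
    rintro ⟨x, hx, hx0⟩
    exact h0 x hx hx0)
  exact ⟨f, hf, he⟩

/-- The loop `ℓ` of period `2π` in the punctured plane has winding number `n` about `0`. -/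
def HasWinding (ℓ : ℝ → ℂ) (n : ℤ) : Prop :=
  ∃ L : ℝ → ℂ, Continuous L ∧ (∀ t, Complex.exp (L t) = ℓ t) ∧
    ∀ t, L (t + 2 * Real.pi) = L t + n * (2 * Real.pi * Complex.I)

theorem int_eq_of_add_mul_two_pi_I {z : ℂ} {m n : ℤ}
    (h : z + m * (2 * Real.pi * Complex.I) = z + n * (2 * Real.pi * Complex.I)) : m = n := by
  have h' := mul_right_cancel₀ Complex.two_pi_I_ne_zero (add_left_cancel h)
  exact_mod_cast h'

/-- One period already determines the winding number. This form fits `PreservesOrientationAt`, where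
the argument is given on `[0, 2π]` only. -/
theorem HasWinding.eq_of_log {ℓ : ℝ → ℂ} {m n : ℤ} (h : HasWinding ℓ m) {L : ℝ → ℂ}
    (hL : ContinuousOn L (Icc 0 (2 * Real.pi)))
    (he : ∀ t ∈ Icc 0 (2 * Real.pi), Complex.exp (L t) = ℓ t)
    (hn : L (2 * Real.pi) = L 0 + n * (2 * Real.pi * Complex.I)) : m = n := by
  obtain ⟨M, hM, hMe, hMn⟩ := h
  obtain ⟨k, hk⟩ := (isPreconnected_Icc (a := (0 : ℝ)) (b := 2 * Real.pi)).exists_int_of_exp_eq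
    hM.continuousOn hL (fun t ht => by rw [hMe, he t ht])
  have hpi := Real.two_pi_pos
  have h0 := hk 0 ⟨le_rfl, hpi.le⟩
  have h1 := hk (2 * Real.pi) ⟨hpi.le, le_rfl⟩
  have h2 := hMn 0
  rw [zero_add] at h2
  refine int_eq_of_add_mul_two_pi_I (z := L 0) ?_
  rw [← hn]
  linear_combination h1 - h0 - h2

theorem HasWinding.unique {ℓ : ℝ → ℂ} {m n : ℤ} (h : HasWinding ℓ m) (h' : HasWinding ℓ n) :
    m = n := by
  obtain ⟨L, hL, he, hn⟩ := h'
  exact h.eq_of_log hL.continuousOn (fun t _ => he t) (by simpa using hn 0)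

theorem HasWinding.div {ℓ ℓ' : ℝ → ℂ} {m n : ℤ} (h : HasWinding ℓ m) (h' : HasWinding ℓ' n) :
    HasWinding (fun t => ℓ t / ℓ' t) (m - n) := by
  obtain ⟨L, hL, he, hn⟩ := h
  obtain ⟨L', hL', he', hn'⟩ := h'
  refine ⟨fun t => L t - L' t, hL.sub hL', fun t => by rw [Complex.exp_sub, he, he'],
    fun t => ?_⟩
  simp only [hn, hn']
  push_cast
  ring

/-- The loop stays in a disc about `w` that misses `0`, so after division by `w` the principal
logarithm is continuous along it. -/
theorem hasWinding_zero_of_norm_sub_lt {ℓ : ℝ → ℂ} (hℓ : Continuous ℓ)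
    (hp : ∀ t, ℓ (t + 2 * Real.pi) = ℓ t) {w : ℂ} (hw : ∀ t, ‖ℓ t - w‖ < ‖w‖) :
    HasWinding ℓ 0 := by
  have hw0 : w ≠ 0 := by
    rintro rfl
    simpa using (norm_nonneg _).trans_lt (hw 0)
  have hs : ∀ t, ℓ t / w ∈ Complex.slitPlane := by
    intro t
    have : ‖ℓ t / w - 1‖ < 1 := by
      rw [div_sub_one hw0, norm_div, div_lt_one (norm_pos_iff.mpr hw0)]
      exact hw t
    have := Complex.ball_one_subset_slitPlane (mem_ball_iff_norm.mpr this)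
    exact this
  refine ⟨fun t => Complex.log (ℓ t / w) + Complex.log w,
    ((hℓ.div_const w).clog hs).add continuous_const, fun t => ?_, fun t => by simp [hp]⟩
  rw [Complex.exp_add, Complex.exp_log (Complex.slitPlane_ne_zero (hs t)), Complex.exp_log hw0,
    div_mul_cancel₀ _ hw0]

theorem hasWinding_circleMap (z : ℂ) {r : ℝ} (hr : 0 < r) :
    HasWinding (fun t => circleMap z r t - z) 1 := by
  refine ⟨fun t => Real.log r + t * Complex.I, by fun_prop, fun t => ?_, fun t => ?_⟩
  · rw [Complex.exp_add, ← Complex.ofReal_exp, Real.exp_log hr]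
    simp [circleMap]
  · push_cast
    ring

end Winding

/-! ### The local degree of a map of the plane -/

section LocalDegree

/-- Triples (centre, radius, angle) form a convex set, on which injectivity keeps the difference
nonzero. A logarithm on this set changes by one constant when the angle grows by `2π`, so the
winding number depends on neither centre nor radius. -/
theorem exists_hasWinding_of_injOn {g : ℂ → ℂ} {z₀ : ℂ} {R : ℝ} (hR : 0 < R)
    (hg : ContinuousOn g (Metric.ball z₀ R)) (hi : InjOn g (Metric.ball z₀ R)) :
    ∃ n : ℤ, ∀ z r, 0 < r → dist z z₀ + r < R →
      HasWinding (fun t => g (circleMap z r t) - g z) n := by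
  let T : Set (ℂ × ℝ × ℝ) := {p | 0 < p.2.1 ∧ dist p.1 z₀ + p.2.1 < R}
  have hT : Convex ℝ T := by
    have h1 : Convex ℝ {p : ℂ × ℝ × ℝ | 0 < p.2.1} :=
      convex_halfSpace_gt (f := fun p : ℂ × ℝ × ℝ => p.2.1)
        ⟨fun _ _ => rfl, fun _ _ => rfl⟩ 0
    have h2 : ConvexOn ℝ univ (fun p : ℂ × ℝ × ℝ => dist p.1 z₀ + p.2.1) := by
      refine ⟨convex_univ, fun p _ q _ a b ha hb hab => ?_⟩
      have := (convexOn_univ_dist z₀).2 (mem_univ p.1) (mem_univ q.1) ha hb hab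
      simp only [smul_eq_mul, Prod.fst_add, Prod.smul_fst, Prod.snd_add, Prod.smul_snd] at this ⊢
      linarith
    have h3 := h2.convex_lt R
    simp only [mem_univ, true_and] at h3
    exact h1.inter h3
  have hTo : IsOpen T :=
    (isOpen_lt (f := fun _ : ℂ × ℝ × ℝ => (0 : ℝ)) (g := fun p => p.2.1) (by fun_prop)
      (by fun_prop)).inter (isOpen_lt (f := fun p : ℂ × ℝ × ℝ => dist p.1 z₀ + p.2.1)
        (g := fun _ => R) (by fun_prop) (by fun_prop))
  have hTn : T.Nonempty := ⟨(z₀, R / 2, 0), by simp [T, hR]⟩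
  have hc : ∀ p ∈ T, circleMap p.1 p.2.1 p.2.2 ∈ Metric.ball z₀ R := by
    rintro ⟨z, r, t⟩ ⟨h1, h2⟩
    rw [Metric.mem_ball]
    refine (dist_triangle _ z _).trans_lt ?_
    have : dist (circleMap z r t) z = r := by simp [dist_eq_norm, circleMap_sub_center, abs_of_pos h1]
    simp only at h1 h2 ⊢
    linarith
  have hz : ∀ p ∈ T, p.1 ∈ Metric.ball z₀ R := by
    rintro ⟨z, r, t⟩ ⟨h1, h2⟩
    simp only at h1 h2
    simp only [Metric.mem_ball]
    linarith
  have hcm : Continuous fun p : ℂ × ℝ × ℝ => circleMap p.1 p.2.1 p.2.2 := by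
    unfold circleMap
    fun_prop
  obtain ⟨L, hL, hLe⟩ := hT.exists_continuousOn_log hTn hTo
    (g := fun p => g (circleMap p.1 p.2.1 p.2.2) - g p.1)
    ((hg.comp hcm.continuousOn hc).sub (hg.comp continuous_fst.continuousOn hz)) (by
      intro p hp h
      have := hi (hc p hp) (hz p hp) (sub_eq_zero.mp h)
      rw [circleMap_eq_center_iff] at this
      exact hp.1.ne' this)
  let τ : ℂ × ℝ × ℝ → ℂ × ℝ × ℝ := fun p => (p.1, p.2.1, p.2.2 + 2 * Real.pi)
  have hτ : MapsTo τ T T := fun p hp => hp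
  obtain ⟨n, hn⟩ := hT.isPreconnected.exists_int_of_exp_eq
    (hL.comp (by fun_prop : Continuous τ).continuousOn hτ) hL (by
      intro p hp
      simp only [Function.comp_apply]
      rw [hLe _ (hτ hp), hLe p hp]
      simp only [τ, (periodic_circleMap p.1 p.2.1) p.2.2])
  refine ⟨n, fun z r hr hzr => ⟨fun t => L (z, r, t), ?_, fun t => hLe _ ⟨hr, hzr⟩,
    fun t => hn (z, r, t) ⟨hr, hzr⟩⟩⟩
  exact hL.comp_continuous (by fun_prop) (fun t => ⟨hr, hzr⟩)

/-- The map `g`, continuous and injective near `z`, has local degree `n` at `z`. -/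
def HasLocalDegree (g : ℂ → ℂ) (z : ℂ) (n : ℤ) : Prop :=
  ∃ R > 0, ContinuousOn g (Metric.ball z R) ∧ InjOn g (Metric.ball z R) ∧
    ∀ r, 0 < r → r < R → HasWinding (fun t => g (circleMap z r t) - g z) n

theorem exists_hasLocalDegree {g : ℂ → ℂ} {U : Set ℂ} {z : ℂ} (hU : U ∈ 𝓝 z)
    (hg : ContinuousOn g U) (hi : InjOn g U) : ∃ n, HasLocalDegree g z n := by
  obtain ⟨R, hR, hRU⟩ := Metric.mem_nhds_iff.mp hU
  obtain ⟨n, hn⟩ := exists_hasWinding_of_injOn hR (hg.mono hRU) (hi.mono hRU)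
  exact ⟨n, R, hR, hg.mono hRU, hi.mono hRU, fun r h0 h1 => hn z r h0 (by simpa using h1)⟩

namespace HasLocalDegree

variable {g h : ℂ → ℂ} {z : ℂ} {m n : ℤ}

theorem unique (hm : HasLocalDegree g z m) (hn : HasLocalDegree g z n) : m = n := by
  obtain ⟨R, hR, -, -, hw⟩ := hm
  obtain ⟨R', hR', -, -, hw'⟩ := hn
  have h0 : 0 < min R R' / 2 := by positivity
  have h1 : min R R' / 2 < min R R' := by linarith
  exact (hw _ h0 (h1.trans_le (min_le_left _ _))).unique (hw' _ h0 (h1.trans_le (min_le_right _ _)))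

/-- Local constancy is what later transfers the degree between a puncture and the nearby points of
the surface. -/
theorem eventually (hn : HasLocalDegree g z n) : ∀ᶠ w in 𝓝 z, HasLocalDegree g w n := by
  obtain ⟨R, hR, hg, hi, hw⟩ := hn
  obtain ⟨k, hk⟩ := exists_hasWinding_of_injOn hR hg hi
  have hkn : k = n := (hk z (R / 2) (by positivity) (by simp [hR])).unique
    (hw (R / 2) (by positivity) (by linarith))
  subst hkn
  filter_upwards [Metric.ball_mem_nhds z hR] with w hw'
  have hd : dist w z < R := hw'
  have hsub : Metric.ball w (R - dist w z) ⊆ Metric.ball z R :=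
    Metric.ball_subset_ball' (by linarith)
  exact ⟨R - dist w z, by linarith, hg.mono hsub, hi.mono hsub,
    fun r h0 h1 => hk w r h0 (by linarith)⟩

theorem congr (hn : HasLocalDegree g z n) (hgh : g =ᶠ[𝓝 z] h) : HasLocalDegree h z n := by
  obtain ⟨R, hR, hg, hi, hw⟩ := hn
  obtain ⟨R', hR', he⟩ := Metric.eventually_nhds_iff_ball.mp hgh
  have hsub : Metric.ball z (min R R') ⊆ Metric.ball z R := Metric.ball_subset_ball (min_le_left _ _)
  have heq : EqOn g h (Metric.ball z (min R R')) :=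
    fun w hw => he w (Metric.ball_subset_ball (min_le_right _ _) hw)
  refine ⟨min R R', by positivity, (hg.mono hsub).congr heq.symm, (hi.mono hsub).congr heq,
    fun r h0 h1 => ?_⟩
  have hc := hw r h0 (h1.trans_le (min_le_left _ _))
  have : (fun t => h (circleMap z r t) - h z) = fun t => g (circleMap z r t) - g z := by
    ext t
    rw [heq (x := z) (Metric.mem_ball_self (by positivity)),
      heq (x := circleMap z r t) (by simpa [dist_eq_norm, circleMap_sub_center, abs_of_pos h0] using h1)]
  rwa [this]

theorem id (z : ℂ) : HasLocalDegree (fun w => w) z 1 :=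
  ⟨1, one_pos, continuousOn_id, injOn_id _, fun _ h0 _ => hasWinding_circleMap z h0⟩

/-- In logarithmic coordinates about `g z` and `h (g z)`, the map `h` lifts to `Φ` with `Φ (ζ + 2πi)
= Φ ζ + 2πi n`. If `L` is a logarithm along the `g`-image of a circle, then `Φ ∘ L` is one for the
composite, with increment `n * m`. -/
theorem comp (hg : HasLocalDegree g z m) (hh : HasLocalDegree h (g z) n) :
    HasLocalDegree (fun w => h (g w)) z (n * m) := by
  obtain ⟨R, hR, hgc, hgi, hgw⟩ := hg
  obtain ⟨Q, hQ, hhc, hhi, hhw⟩ := hh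
  obtain ⟨R', hR', hRR'⟩ := Metric.mem_nhds_iff.mp (inter_mem (Metric.ball_mem_nhds z hR)
    ((hgc.continuousAt (Metric.ball_mem_nhds z hR)).preimage_mem_nhds
      (Metric.ball_mem_nhds (g z) hQ)))
  have hR1 : Metric.ball z R' ⊆ Metric.ball z R := fun w hw => (hRR' hw).1
  have hR2 : MapsTo g (Metric.ball z R') (Metric.ball (g z) Q) := fun w hw => (hRR' hw).2
  refine ⟨min R R', by positivity, ?_, ?_, fun r h0 h1 => ?_⟩
  · exact (hhc.comp (hgc.mono hR1) hR2).mono (Metric.ball_subset_ball (min_le_right _ _))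
  · exact (hhi.comp (hgi.mono hR1) hR2).mono (Metric.ball_subset_ball (min_le_right _ _))
  obtain ⟨L, hL, hLe, hLn⟩ := hgw r h0 (h1.trans_le (min_le_left _ _))
  -- The exponential maps this half-plane onto the punctured disc of radius `Q`.
  let H : Set ℂ := {ζ | ζ.re < Real.log Q}
  have hH : Convex ℝ H := convex_halfSpace_re_lt _
  have hHo : IsOpen H := isOpen_lt Complex.continuous_re continuous_const
  have hHn : H.Nonempty := ⟨((Real.log Q - 1 : ℝ) : ℂ), by
    simp only [H, mem_ofPred_eq, Complex.ofReal_re]; linarith⟩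
  have hHb : MapsTo (fun ζ => g z + Complex.exp ζ) H (Metric.ball (g z) Q) := by
    intro ζ hζ
    simp only [Metric.mem_ball, dist_self_add_left, Complex.norm_exp]
    exact (Real.lt_log_iff_exp_lt hQ).mp hζ
  obtain ⟨Φ, hΦ, hΦe⟩ := hH.exists_continuousOn_log hHn hHo
    (g := fun ζ => h (g z + Complex.exp ζ) - h (g z))
    ((hhc.comp (by fun_prop) hHb).sub continuousOn_const) (by
      intro ζ hζ h0
      have := hhi (hHb hζ) (Metric.mem_ball_self hQ) (sub_eq_zero.mp h0)
      simp [Complex.exp_ne_zero] at this)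
  have hτ : ∀ k : ℤ, MapsTo (fun ζ : ℂ => ζ + k * (2 * Real.pi * Complex.I)) H H := by
    intro k ζ hζ
    simpa [H] using hζ
  obtain ⟨k, hk⟩ := hH.isPreconnected.exists_int_of_exp_eq
    (hΦ.comp (by fun_prop) (hτ 1)) hΦ (by
      intro ζ hζ
      simp only [Function.comp_apply]
      rw [hΦe _ (hτ 1 hζ), hΦe ζ hζ]
      simp [Complex.exp_periodic ζ])
  -- The vertical line with real part `log (Q / 2)` covers the circle of radius `Q / 2`, on which
  -- the winding number of `h` is known.
  have hkn : k = n := by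
    have hq : 0 < Q / 2 := by positivity
    have hmem : ∀ t : ℝ, ((Real.log (Q / 2) : ℝ) + t * Complex.I : ℂ) ∈ H := by
      intro t
      simp only [H, mem_ofPred_eq, Complex.add_re, Complex.ofReal_re, Complex.re_ofReal_mul,
        Complex.I_re, mul_zero, add_zero]
      exact Real.log_lt_log hq (by linarith)
    refine HasWinding.unique ⟨fun t => Φ ((Real.log (Q / 2) : ℝ) + t * Complex.I),
      hΦ.comp_continuous (by fun_prop) hmem, fun t => ?_, fun t => ?_⟩
      (hhw (Q / 2) hq (by linarith))
    · rw [hΦe _ (hmem t)]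
      congr 2
      rw [Complex.exp_add, ← Complex.ofReal_exp, Real.exp_log hq, circleMap]
    · have := hk _ (hmem t)
      simp only [Function.comp_apply, Int.cast_one, one_mul] at this
      refine Eq.trans (congrArg Φ ?_) this
      push_cast
      ring
  subst hkn
  have hLH : ∀ t, L t ∈ H := by
    intro t
    have h2 : circleMap z r t ∈ Metric.ball z R' := by
      simpa [dist_eq_norm, circleMap_sub_center, abs_of_pos h0] using
        h1.trans_le (min_le_right _ _)
    have h3 := hR2 h2
    have h4 : Complex.exp (L t) = g (circleMap z r t) - g z := hLe t
    rw [mem_ball_iff_norm, ← h4, Complex.norm_exp] at h3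
    exact (Real.lt_log_iff_exp_lt hQ).mpr h3
  have hmul : ∀ (j : ℤ), ∀ ζ ∈ H, Φ (ζ + j * (2 * Real.pi * Complex.I)) =
      Φ ζ + (k * j : ℤ) * (2 * Real.pi * Complex.I) := by
    intro j
    induction j using Int.induction_on with
    | zero => intro ζ _; simp
    | succ i ih =>
      intro ζ hζ
      have h1 := hk _ (hτ i hζ)
      have h2 := ih ζ hζ
      simp only [Function.comp_apply, Int.cast_one, one_mul] at h1
      push_cast at h1 h2 ⊢
      rw [add_mul, one_mul, ← add_assoc, h1, h2]
      ring
    | pred i ih =>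
      intro ζ hζ
      have h1 := hk _ (hτ (-i - 1) hζ)
      have h2 := ih ζ hζ
      simp only [Function.comp_apply, Int.cast_one, one_mul] at h1
      push_cast at h1 h2 ⊢
      rw [show ζ + (-(i : ℂ) - 1) * (2 * Real.pi * Complex.I) + 2 * Real.pi * Complex.I =
        ζ + -(i : ℂ) * (2 * Real.pi * Complex.I) by ring, h2] at h1
      linear_combination -h1
  refine ⟨fun t => Φ (L t), hΦ.comp_continuous hL hLH, fun t => ?_, fun t => ?_⟩
  · rw [hΦe _ (hLH t), hLe]
    simp
  · simp only [hLn, hmul _ _ (hLH t)]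

end HasLocalDegree

theorem PreservesOrientationAt.hasLocalDegree {g : ℂ → ℂ} {z : ℂ} (h : PreservesOrientationAt g z)
    {U : Set ℂ} (hU : U ∈ 𝓝 z) (hg : ContinuousOn g U) (hi : InjOn g U) :
    HasLocalDegree g z 1 := by
  obtain ⟨n, hn⟩ := exists_hasLocalDegree hU hg hi
  suffices n = 1 by rwa [← this]
  obtain ⟨R, hR, hgc, hgi, hw⟩ := hn
  obtain ⟨r, ⟨θ, hθ, hθ1, hθe⟩, hr⟩ := (h.and (Ioo_mem_nhdsGT hR)).exists
  have hcm : ∀ t, circleMap z r t ∈ Metric.ball z R := fun t => by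
    simpa [dist_eq_norm, circleMap_sub_center, abs_of_pos hr.1] using hr.2
  have hne : ∀ t, ‖g (circleMap z r t) - g z‖ ≠ 0 := by
    intro t h0
    have := hgi (hcm t) (Metric.mem_ball_self hR) (sub_eq_zero.mp (norm_eq_zero.mp h0))
    rw [circleMap_eq_center_iff] at this
    exact hr.1.ne' this
  refine (hw r hr.1 hr.2).eq_of_log
    (L := fun t => (Real.log ‖g (circleMap z r t) - g z‖ : ℝ) + θ t * Complex.I) ?_ ?_ ?_
  · have h1 : Continuous fun t => g (circleMap z r t) - g z :=
      (hgc.comp_continuous (continuous_circleMap z r) hcm).sub continuous_const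
    have h2 : Continuous fun t => Real.log ‖g (circleMap z r t) - g z‖ := h1.norm.log hne
    exact (Complex.continuous_ofReal.comp h2).continuousOn.add
      ((Complex.continuous_ofReal.comp_continuousOn hθ).mul continuousOn_const)
  · intro t ht
    rw [Complex.exp_add, ← Complex.ofReal_exp, Real.exp_log ((norm_nonneg _).lt_of_ne' (hne t)),
      ← hθe t ht]
  · have : circleMap z r (2 * Real.pi) = circleMap z r 0 := by
      simpa using periodic_circleMap z r 0
    simp only [this, hθ1]
    push_cast
    ring

end LocalDegree

/-! ### Charts onto the plane -/

section Charts

variable {S : Type*} [TopologicalSpace S]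

/-- A small round ball in a chart is homeomorphic to the plane. With the whole plane as target, the
inverse chart is a continuous injection defined everywhere. -/
theorem exists_chart_target_univ [ChartedSpace ℂ S] {O : Set S} (hO : IsOpen O) {y : S}
    (hy : y ∈ O) : ∃ c : OpenPartialHomeomorph S ℂ,
      c.target = univ ∧ y ∈ c.source ∧ c.source ⊆ O ∧ c y = 0 := by
  let e := chartAt ℂ y
  have hye : y ∈ e.source := mem_chart_source ℂ y
  have hn : e.target ∩ e.symm ⁻¹' O ∈ 𝓝 (e y) :=
    inter_mem (e.open_target.mem_nhds (e.map_source hye))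
      ((e.continuousAt_symm (e.map_source hye)).preimage_mem_nhds
        (hO.mem_nhds (by rwa [e.left_inv hye])))
  obtain ⟨r, hr, hball⟩ := Metric.mem_nhds_iff.mp hn
  refine ⟨e.trans (OpenPartialHomeomorph.univBall (e y) r).symm, ?_, ?_, ?_, ?_⟩
  · rw [OpenPartialHomeomorph.trans_target]
    ext z
    have hz : OpenPartialHomeomorph.univBall (e y) r z ∈ Metric.ball (e y) r := by
      have := (OpenPartialHomeomorph.univBall (e y) r).map_source (x := z) (by simp)
      rwa [OpenPartialHomeomorph.univBall_target _ hr] at this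
    simpa using (hball hz).1
  · simp [hye, OpenPartialHomeomorph.univBall_target _ hr, hr]
  · rw [OpenPartialHomeomorph.trans_source]
    rintro x ⟨hx, hx'⟩
    simp only [OpenPartialHomeomorph.symm_source, OpenPartialHomeomorph.univBall_target _ hr] at hx'
    have := (hball hx').2
    rwa [mem_preimage, e.left_inv hx] at this
  · simp

variable {c : OpenPartialHomeomorph S ℂ}

theorem continuous_symm_of_target_univ (hc : c.target = univ) : Continuous c.symm := by
  rw [← continuousOn_univ, ← hc]
  exact c.continuousOn_symm

theorem injective_symm_of_target_univ (hc : c.target = univ) : Function.Injective c.symm := by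
  rw [← injOn_univ, ← hc]
  exact c.symm.injOn

theorem symm_mem_source_of_target_univ (hc : c.target = univ) (z : ℂ) : c.symm z ∈ c.source :=
  c.map_target (by simp [hc])

theorem right_inv_of_target_univ (hc : c.target = univ) (z : ℂ) : c (c.symm z) = z :=
  c.right_inv (by simp [hc])

/-- Extension by the identity of a map of the plane, transported to a surface by a chart. -/
def chartExtend (c : OpenPartialHomeomorph S ℂ) (k : ℂ → ℂ) (x : S) : S :=
  open Classical in if x ∈ c.source then c.symm (k (c x)) else x

theorem chartExtend_of_mem {k : ℂ → ℂ} {x : S} (hx : x ∈ c.source) :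
    chartExtend c k x = c.symm (k (c x)) :=
  if_pos hx

theorem chartExtend_of_notMem {k : ℂ → ℂ} {x : S} (hx : x ∉ c.source) : chartExtend c k x = x :=
  if_neg hx

/-- Off the compact, hence closed, image of the ball of radius `R` the map is the identity, which
settles continuity outside the chart domain. -/
theorem continuous_chartExtend [T2Space S] (hc : c.target = univ) {k : ℂ → ℂ} (hk : Continuous k)
    {R : ℝ} (hR : ∀ z, R ≤ ‖z‖ → k z = z) : Continuous (chartExtend c k) := by
  rw [continuous_iff_continuousAt]
  intro x
  have hs := continuous_symm_of_target_univ hc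
  by_cases hx : x ∈ c.source
  · have h1 : ContinuousAt (fun x => c.symm (k (c x))) x :=
      (hs.comp hk).continuousAt.comp (c.continuousAt hx)
    refine h1.congr ?_
    filter_upwards [c.open_source.mem_nhds hx] with y hy
    exact (chartExtend_of_mem hy).symm
  · have hC : IsClosed (c.symm '' Metric.closedBall 0 R) :=
      ((isCompact_closedBall (0 : ℂ) R).image hs).isClosed
    have hxC : x ∉ c.symm '' Metric.closedBall 0 R := by
      rintro ⟨z, -, rfl⟩
      exact hx (symm_mem_source_of_target_univ hc z)
    refine continuousAt_id.congr ?_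
    filter_upwards [hC.isOpen_compl.mem_nhds hxC] with y hy
    by_cases hys : y ∈ c.source
    · rw [chartExtend_of_mem hys, hR, c.left_inv hys, id]
      by_contra! h
      exact hy ⟨c y, by simpa using h.le, c.left_inv hys⟩
    · rw [chartExtend_of_notMem hys, id]

theorem chartExtend_chartExtend (hc : c.target = univ) {k l : ℂ → ℂ} (hkl : ∀ z, k (l z) = z)
    (x : S) : chartExtend c k (chartExtend c l x) = x := by
  by_cases hx : x ∈ c.source
  · rw [chartExtend_of_mem hx, chartExtend_of_mem (symm_mem_source_of_target_univ hc _),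
      right_inv_of_target_univ hc, hkl, c.left_inv hx]
  · rw [chartExtend_of_notMem hx, chartExtend_of_notMem hx]

/-- Extension by the identity of a compactly supported homeomorphism of the plane. -/
def chartExtendHomeomorph [T2Space S] (hc : c.target = univ) (k : ℂ ≃ₜ ℂ) {R : ℝ}
    (hR : ∀ z, R ≤ ‖z‖ → k z = z) : S ≃ₜ S where
  toFun := chartExtend c k
  invFun := chartExtend c k.symm
  left_inv := chartExtend_chartExtend hc (by simp)
  right_inv := chartExtend_chartExtend hc (by simp)
  continuous_toFun := continuous_chartExtend hc k.continuous hR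
  continuous_invFun := continuous_chartExtend hc k.symm.continuous
    (fun z hz => by rw [k.symm_apply_eq, hR z hz])

/-- The plane is homogeneous under compactly supported homeomorphisms. -/
theorem exists_homeomorph_apply_eq_zero (w : ℂ) :
    ∃ k : ℂ ≃ₜ ℂ, k w = 0 ∧ ∃ R : ℝ, ∀ z, R ≤ ‖z‖ → k z = z := by
  let ρ : ℝ := ‖w‖ + 1
  have hρ : 0 < ρ := by positivity
  -- A tent function centred at `w` pushes `w` to `0`. The perturbation of the identity has
  -- Lipschitz constant `‖w‖ / (‖w‖ + 1) < 1`, which makes `k` a homeomorphism.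
  let k : ℂ → ℂ := fun z => z - (max 0 (1 - ‖z - w‖ / ρ) : ℝ) * w
  have hlip : ∀ x y : ℂ, |max 0 (1 - ‖x - w‖ / ρ) - max 0 (1 - ‖y - w‖ / ρ)| ≤ ‖x - y‖ / ρ := by
    intro x y
    refine (abs_max_sub_max_le_max _ _ _ _).trans ?_
    rw [sub_self, abs_zero, max_eq_right (abs_nonneg _)]
    have : 1 - ‖x - w‖ / ρ - (1 - ‖y - w‖ / ρ) = (‖y - w‖ - ‖x - w‖) / ρ := by ring
    rw [this, abs_div, abs_of_pos hρ]
    gcongr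
    refine (abs_norm_sub_norm_le _ _).trans ?_
    rw [sub_sub_sub_cancel_right, norm_sub_rev]
  have happ : ApproximatesLinearOn k ((ContinuousLinearEquiv.refl ℂ ℂ : ℂ ≃L[ℂ] ℂ) : ℂ →L[ℂ] ℂ)
      univ (‖w‖₊ / (‖w‖₊ + 1)) := by
    intro x _ y _
    have : k x - k y - ((ContinuousLinearEquiv.refl ℂ ℂ : ℂ ≃L[ℂ] ℂ) : ℂ →L[ℂ] ℂ) (x - y) =
        -(((max 0 (1 - ‖x - w‖ / ρ) - max 0 (1 - ‖y - w‖ / ρ) : ℝ) : ℂ) * w) := by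
      simp only [k, ContinuousLinearEquiv.coe_coe, ContinuousLinearEquiv.refl_apply]
      push_cast
      ring
    rw [this, norm_neg, norm_mul, Complex.norm_real, Real.norm_eq_abs]
    calc _ ≤ ‖x - y‖ / ρ * ‖w‖ := by gcongr; exact hlip x y
      _ = _ := by simp only [NNReal.coe_div, coe_nnnorm, NNReal.coe_add, NNReal.coe_one, ρ]; ring
  have hlt : ‖w‖₊ / (‖w‖₊ + 1) <
      ‖((ContinuousLinearEquiv.refl ℂ ℂ : ℂ ≃L[ℂ] ℂ).symm : ℂ →L[ℂ] ℂ)‖₊⁻¹ := by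
    have h1 : ‖((ContinuousLinearEquiv.refl ℂ ℂ : ℂ ≃L[ℂ] ℂ).symm : ℂ →L[ℂ] ℂ)‖₊ = 1 := by
      ext
      exact ContinuousLinearMap.norm_id
    rw [h1, inv_one, div_lt_one (by positivity)]
    exact lt_add_one _
  refine ⟨happ.toHomeomorph _ (Or.inr hlt), ?_, ‖w‖ + ρ, fun z hz => ?_⟩
  · change k w = 0
    simp [k]
  · change k z = z
    have : ρ ≤ ‖z - w‖ := by
      have := norm_sub_norm_le z w
      linarith
    have : 1 ≤ ‖z - w‖ / ρ := (one_le_div hρ).mpr this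
    simp [k, max_eq_left (sub_nonpos.mpr this)]

end Charts

/-! ### Neighbourhoods of punctures -/

section Punctures

variable {S : Type*} [TopologicalSpace S]

/-- The plane has real dimension two, so removing a countable set leaves it path connected. -/
theorem isPathConnected_source_punctured {c : OpenPartialHomeomorph S ℂ} (hc : c.target = univ)
    (P : Finset S) : IsPathConnected {x : Punctured S P | (x : S) ∈ c.source} := by
  have hA : IsPathConnected (c.symm ⁻¹' (P : Set S))ᶜ := by
    refine Set.Countable.isPathConnected_compl_of_one_lt_rank (by simp) ?_
    exact (P.finite_toSet.preimage (injective_symm_of_target_univ hc).injOn).countable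
  have hi : IsInducing (Subtype.val : Punctured S P → S) := ⟨rfl⟩
  rw [hi.isPathConnected_iff]
  convert hA.image (continuous_symm_of_target_univ hc) using 1
  ext x
  constructor
  · rintro ⟨y, hy, rfl⟩
    exact ⟨c y, by simpa [c.left_inv hy] using y.2, c.left_inv hy⟩
  · rintro ⟨z, hz, rfl⟩
    exact ⟨⟨c.symm z, hz⟩, symm_mem_source_of_target_univ hc z, rfl⟩

theorem punctureFilter_neBot [ChartedSpace ℂ S] (P : Finset S) (p : S) :
    (punctureFilter P p).NeBot := by
  refine comap_neBot fun t ht => ?_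
  obtain ⟨O, hOt, hO, hp⟩ := mem_nhds_iff.mp ht
  obtain ⟨c, hc, -, hcO, -⟩ := exists_chart_target_univ hO hp
  obtain ⟨x, hx⟩ := (isPathConnected_source_punctured hc P).nonempty
  exact ⟨x, hOt (hcO hx)⟩

theorem eq_of_punctureFilter_le [T2Space S] [ChartedSpace ℂ S] {P : Finset S} {p q : S}
    (h : punctureFilter P p ≤ punctureFilter P q) : p = q := by
  have := punctureFilter_neBot P p
  have h1 : Tendsto (Subtype.val : Punctured S P → S) (punctureFilter P p) (𝓝 p) := tendsto_comap
  have h2 : Tendsto (Subtype.val : Punctured S P → S) (punctureFilter P p) (𝓝 q) :=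
    tendsto_comap.mono_left h
  exact tendsto_nhds_unique h1 h2

/-- The complement of `W` is a compact subset of the punctured surface. So is its preimage under
`f`, which is therefore closed in `S` and misses `p`. -/
theorem mem_punctureFilter_of_homeomorph [T2Space S] [CompactSpace S] {P : Finset S}
    (f : Punctured S P ≃ₜ Punctured S P) {W : Set S} (hW : IsOpen W) (hPW : (P : Set S) ⊆ W)
    {p : S} (hp : p ∈ P) : {x | (f x : S) ∈ W} ∈ punctureFilter P p := by
  have hC : IsCompact ((Subtype.val : Punctured S P → S) ⁻¹' Wᶜ) := by
    have hi : IsInducing (Subtype.val : Punctured S P → S) := ⟨rfl⟩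
    exact hi.isCompact_preimage' hW.isClosed_compl.isCompact
      fun x hx => ⟨⟨x, fun h => hx (hPW h)⟩, rfl⟩
  have hC' := ((hC.image f.symm.continuous).image continuous_subtype_val).isClosed
  refine mem_comap.mpr ⟨_, hC'.isOpen_compl.mem_nhds ?_, fun x hx => ?_⟩
  · rintro ⟨x, -, rfl⟩
    exact x.2 hp
  · by_contra h
    exact hx ⟨x, ⟨f x, h, f.symm_apply_apply x⟩, rfl⟩

/-- Near `p` the values of `f` lie in a union of disjoint neighbourhoods of the punctures. A
punctured disc about `p` is connected, so a single neighbourhood receives it. -/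
theorem exists_map_punctureFilter_le [T2Space S] [CompactSpace S] [ChartedSpace ℂ S] {P : Finset S}
    (f : Punctured S P ≃ₜ Punctured S P) {p : S} (hp : p ∈ P) :
    ∃ q ∈ P, map f (punctureFilter P p) ≤ punctureFilter P q := by
  obtain ⟨U, hU, hd⟩ := P.finite_toSet.t2_separation
  have key : ∀ W : S → Set S, (∀ r ∈ P, r ∈ W r ∧ IsOpen (W r)) →
      {x | (f x : S) ∈ ⋃ r ∈ P, W r} ∈ punctureFilter P p := fun W hW =>
    mem_punctureFilter_of_homeomorph f (isOpen_biUnion fun r hr => (hW r hr).2)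
      (fun r hr => mem_biUnion hr (hW r hr).1) hp
  obtain ⟨t, ht, htU⟩ := mem_comap.mp (key U fun r _ => hU r)
  obtain ⟨O, hOt, hO, hpO⟩ := mem_nhds_iff.mp ht
  obtain ⟨c, hc, hpc, hcO, -⟩ := exists_chart_target_univ hO hpO
  have hD := isPathConnected_source_punctured hc P
  set D : Set (Punctured S P) := {x | (x : S) ∈ c.source}
  have hDU : ∀ x ∈ D, (f x : S) ∈ ⋃ r ∈ P, U r := fun x hx => htU (hOt (hcO hx))
  obtain ⟨x, hx⟩ := hD.nonempty
  obtain ⟨q, hq, hxq⟩ := mem_iUnion₂.mp (hDU x hx)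
  have hDq : ∀ y ∈ D, (f y : S) ∈ U q := by
    have hpre : IsPreconnected ((fun y => (f y : S)) '' D) :=
      hD.isConnected.isPreconnected.image _
        (continuous_subtype_val.comp f.continuous).continuousOn
    have hsub : (fun y => (f y : S)) '' D ⊆ U q := by
      refine hpre.subset_left_of_subset_union (hU q).2
        (v := ⋃ r ∈ {r | r ∈ P ∧ r ≠ q}, U r) (isOpen_biUnion fun r _ => (hU r).2) ?_ ?_
        ⟨_, mem_image_of_mem _ hx, hxq⟩
      · exact disjoint_iUnion₂_right.mpr fun r hr => hd hq hr.1 hr.2.symm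
      · rintro _ ⟨y, hy, rfl⟩
        obtain ⟨r, hr, hyr⟩ := mem_iUnion₂.mp (hDU y hy)
        by_cases hrq : r = q
        · exact Or.inl (hrq ▸ hyr)
        · exact Or.inr (mem_biUnion (show r ∈ {r | r ∈ P ∧ r ≠ q} from ⟨hr, hrq⟩) hyr)
    exact fun y hy => hsub ⟨y, hy, rfl⟩
  refine ⟨q, hq, ?_⟩
  intro A hA
  obtain ⟨t', ht', htA⟩ := mem_comap.mp hA
  obtain ⟨W, hWt, hW, hqW⟩ := mem_nhds_iff.mp ht'
  classical
  -- Only the neighbourhood of `q` is shrunk; the others are already excluded on `D`.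
  have h1 := key (fun r => if r = q then W else U r) (by
    intro r _
    by_cases hr : r = q
    · subst hr; simp [hqW, hW]
    · simp [hr, hU r])
  have h2 : D ∈ punctureFilter P p := preimage_mem_comap (c.open_source.mem_nhds hpc)
  rw [mem_map]
  filter_upwards [h1, h2] with y hy1 hy2
  obtain ⟨r, hr, hyr⟩ := mem_iUnion₂.mp hy1
  by_cases hrq : r = q
  · rw [if_pos hrq] at hyr
    exact htA (hWt hyr)
  · rw [if_neg hrq] at hyr
    exact absurd (hDq y hy2) fun h => (hd hr hq hrq).le_bot ⟨hyr, h⟩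

/-- A homeomorphism of a punctured closed surface permutes the punctures. -/
theorem exists_map_punctureFilter_eq [T2Space S] [CompactSpace S] [ChartedSpace ℂ S] {P : Finset S}
    (f : Punctured S P ≃ₜ Punctured S P) {p : S} (hp : p ∈ P) :
    ∃ q ∈ P, map f (punctureFilter P p) = punctureFilter P q := by
  obtain ⟨q, hq, hpq⟩ := exists_map_punctureFilter_le f hp
  -- The inverse sends `q` to some `r`; composing the two inclusions gives `p = r`, and then
  -- equality.
  obtain ⟨r, hr, hqr⟩ := exists_map_punctureFilter_le f.symm hq
  have h1 : map f.symm (map f (punctureFilter P p)) = punctureFilter P p := by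
    rw [map_map, f.symm_comp_self, map_id]
  have hpr : p = r := eq_of_punctureFilter_le (P := P) (h1 ▸ (map_mono hpq).trans hqr)
  subst hpr
  refine ⟨q, hq, le_antisymm hpq ?_⟩
  have h2 := map_mono (m := f) hqr
  rwa [map_map, f.self_comp_symm, map_id] at h2

/-- Two punctures lie in the domain of a chart onto the plane that avoids the other punctures. -/
theorem exists_chart_of_pair [T2Space S] [ChartedSpace ℂ S] (P : Finset S)
    [ConnectedSpace (Punctured S P)] {p q : S} (hp : p ∈ P) (hpq : p ≠ q) :
    ∃ c : OpenPartialHomeomorph S ℂ, c.target = univ ∧ p ∈ c.source ∧ q ∈ c.source ∧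
      ∀ r ∈ P, r ∈ c.source → r = p ∨ r = q := by
  let M : Set S := {y | y ∈ P → y = q}
  have hMo : IsOpen M := by
    have : M = ((P : Set S) \ {q})ᶜ := by
      ext y
      simp [M, imp_iff_not_or]
    rw [this]
    exact (P.finite_toSet.subset sdiff_subset).isClosed.isOpen_compl
  -- `M` lies between the connected punctured surface and its closure in `S`.
  have hMc : IsPreconnected M := by
    have h1 : IsPreconnected (range (Subtype.val : Punctured S P → S)) :=
      isPreconnected_range continuous_subtype_val
    refine h1.subset_closure ?_ fun y _ => ?_
    · rintro _ ⟨x, rfl⟩ hx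
      exact absurd hx x.2
    · have := punctureFilter_neBot P y
      exact mem_closure_of_tendsto (f := (Subtype.val : Punctured S P → S))
        (b := punctureFilter P y) tendsto_comap (Eventually.of_forall mem_range_self)
  let Good : S → Prop := fun y => ∃ c : OpenPartialHomeomorph S ℂ, c.target = univ ∧
    p ∈ c.source ∧ y ∈ c.source ∧ ∀ r ∈ P, r ∈ c.source → r = p ∨ r = q
  -- Within a disc contained in `M`, a homeomorphism supported there moves `y''` to `y'`;
  -- precomposing the chart with it fixes every puncture except possibly `q`. So being good is
  -- locally constant on `M`.
  have hstep : ∀ y ∈ M, ∃ O, IsOpen O ∧ y ∈ O ∧ ∀ y' ∈ O, Good y' → ∀ y'' ∈ O, Good y'' := by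
    intro y hy
    obtain ⟨d, hd, hyd, hdM, -⟩ := exists_chart_target_univ hMo hy
    refine ⟨d.source, d.open_source, hyd, ?_⟩
    rintro y' hy' ⟨c, hc, hpc, hyc, hcP⟩ y'' hy''
    obtain ⟨k, hk, R, hkR⟩ := exists_homeomorph_apply_eq_zero (d y')
    obtain ⟨l, hl, R', hlR⟩ := exists_homeomorph_apply_eq_zero (d y'')
    let h := (chartExtendHomeomorph hd l hlR).trans (chartExtendHomeomorph hd k hkR).symm
    have hfix : ∀ r ∉ d.source, h r = r := by
      intro r hr
      change chartExtend d k.symm (chartExtend d l r) = r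
      rw [chartExtend_of_notMem hr, chartExtend_of_notMem hr]
    have hmove : h y'' = y' := by
      change chartExtend d k.symm (chartExtend d l y'') = y'
      rw [chartExtend_of_mem hy'', hl, chartExtend_of_mem (symm_mem_source_of_target_univ hd _),
        right_inv_of_target_univ hd, k.symm_apply_eq.mpr hk.symm, d.left_inv hy']
    have hfixP : ∀ r ∈ P, r ≠ q → h r = r := fun r hr hrq => hfix r fun hrd => hrq (hdM hrd hr)
    refine ⟨h.transOpenPartialHomeomorph c, by simpa using hc, ?_, ?_, ?_⟩
    · simpa [hfixP p hp hpq] using hpc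
    · simpa [hmove] using hyc
    · intro r hr hrc
      by_cases hrq : r = q
      · exact Or.inr hrq
      · refine hcP r hr ?_
        simpa [hfixP r hr hrq] using hrc
  have hA : IsOpen {y | y ∈ M ∧ Good y} := by
    rw [isOpen_iff_mem_nhds]
    rintro y ⟨hy, hg⟩
    obtain ⟨O, hO, hyO, hOg⟩ := hstep y hy
    filter_upwards [hO.mem_nhds hyO, hMo.mem_nhds hy] with z hz hzM
    exact ⟨hzM, hOg y hyO hg z hz⟩
  have hB : IsOpen {y | y ∈ M ∧ ¬ Good y} := by
    rw [isOpen_iff_mem_nhds]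
    rintro y ⟨hy, hg⟩
    obtain ⟨O, hO, hyO, hOg⟩ := hstep y hy
    filter_upwards [hO.mem_nhds hyO, hMo.mem_nhds hy] with z hz hzM
    exact ⟨hzM, fun hz' => hg (hOg z hz hz' y hyO)⟩
  -- A disc about `p` without other punctures makes its nearby points good.
  have hex : ∃ y ∈ M, Good y := by
    have hO : IsOpen ((P : Set S) \ {p})ᶜ :=
      (P.finite_toSet.subset sdiff_subset).isClosed.isOpen_compl
    obtain ⟨c, hc, hpc, hcO, -⟩ := exists_chart_target_univ hO (y := p) (by simp)
    obtain ⟨x, hx⟩ := (isPathConnected_source_punctured hc P).nonempty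
    refine ⟨x, fun h => absurd h x.2, c, hc, hpc, hx, fun r hr hrc => Or.inl ?_⟩
    by_contra hne
    exact hcO hrc ⟨hr, hne⟩
  obtain ⟨y, hy, hyg⟩ := hex
  have hsub : M ⊆ {y | y ∈ M ∧ Good y} :=
    hMc.subset_left_of_subset_union hA hB
      (disjoint_left.mpr fun z hz hz' => hz'.2 hz.2)
      (fun z hz => (em (Good z)).imp (fun h => ⟨hz, h⟩) (fun h => ⟨hz, h⟩)) ⟨y, hy, hy, hyg⟩
  exact (hsub (show q ∈ M from fun _ => rfl)).2

end Punctures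

/-! ### Finite generation of the fundamental group -/

theorem exists_continuousMap_log {A : Type*} [TopologicalSpace A] [SimplyConnectedSpace A]
    [LocallyPathConnectedSpace A] (ℓ : C(A, ℂ)) (h : ∀ a, ℓ a ≠ 0) :
    ∃ L : C(A, ℂ), ∀ a, Complex.exp (L a) = ℓ a := by
  obtain ⟨a₀⟩ : Nonempty A := inferInstance
  obtain ⟨L, ⟨-, hL⟩, -⟩ := Complex.isCoveringMapOn_exp.existsUnique_continuousMap_lifts ℓ
    (Complex.exp_log (h a₀)) h
  exact ⟨L, fun a => congrFun hL a⟩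

instance : ContractibleSpace I := (convex_Icc (0 : ℝ) 1).contractibleSpace ⟨0, by simp⟩

instance : LocallyPathConnectedSpace I := (convex_Icc (0 : ℝ) 1).locallyPathConnectedSpace

section PathCocycle

variable {X G : Type*} [TopologicalSpace X] [Group G]

/-- A multiplicative function on paths with values in a group, invariant under homotopy relative to
the end points. -/
structure PathCocycle (X G : Type*) [TopologicalSpace X] [Group G] where
  val : ∀ {a b : X}, Path a b → G
  map_trans : ∀ {a b c : X} (γ : Path a b) (δ : Path b c), val (γ.trans δ) = val γ * val δ
  map_homotopic : ∀ {a b : X} {γ δ : Path a b}, γ.Homotopic δ → val γ = val δ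

namespace PathCocycle

variable (Θ : PathCocycle X G)

theorem map_refl (a : X) : Θ.val (Path.refl a) = 1 := by
  have h := Θ.map_homotopic ⟨Path.Homotopy.reflTrans (Path.refl a)⟩
  rw [Θ.map_trans] at h
  exact mul_eq_left.mp h

theorem map_congr {a b a' b' : X} {γ : Path a b} {δ : Path a' b'} (h : ∀ t, γ t = δ t) :
    Θ.val γ = Θ.val δ := by
  obtain rfl : a = a' := by simpa using h 0
  obtain rfl : b = b' := by simpa using h 1
  congr 1
  ext t
  exact h t

/-- The cocycle with values in the fundamental group given by a choice of paths from the base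
point. -/
def ofPathConnected [PathConnectedSpace X] (x₀ : X) : PathCocycle X (FundamentalGroup X x₀) where
  -- The inverse compensates for multiplication in the fundamental group being composition in the
  -- opposite order.
  val {a b} γ := ((FundamentalGroupoid.fromPath (.mk (PathConnectedSpace.somePath x₀ a)) ≫
    FundamentalGroupoid.fromPath (.mk γ) ≫
      Groupoid.inv (FundamentalGroupoid.fromPath (.mk (PathConnectedSpace.somePath x₀ b))) :
      FundamentalGroup X x₀))⁻¹
  map_trans γ δ := by
    rw [← mul_inv_rev, End.mul_def]
    congr 1
    have : FundamentalGroupoid.fromPath (Path.Homotopic.Quotient.mk (γ.trans δ)) =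
      FundamentalGroupoid.fromPath (.mk γ) ≫ FundamentalGroupoid.fromPath (.mk δ) := rfl
    rw [this]
    simp
  map_homotopic h := by
    rw [Path.Homotopic.Quotient.eq.mpr h]

theorem ofPathConnected_surjective [PathConnectedSpace X] (x₀ : X) (g : FundamentalGroup X x₀) :
    ∃ γ : Path x₀ x₀, (ofPathConnected x₀).val γ = g := by
  let τ := FundamentalGroupoid.fromPath (.mk (PathConnectedSpace.somePath x₀ x₀))
  obtain ⟨γ, hγ⟩ := Path.Homotopic.Quotient.mk_surjective
    (Groupoid.inv τ ≫ (g⁻¹ : FundamentalGroup X x₀) ≫ τ)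
  refine ⟨γ, ?_⟩
  change (τ ≫ Path.Homotopic.Quotient.mk γ ≫ Groupoid.inv τ : FundamentalGroup X x₀)⁻¹ = g
  rw [inv_eq_iff_eq_inv, hγ]
  generalize g⁻¹ = h
  simp

/-- Invariance gives `B 0 ζ = B (kω) (ζ + kω)`, and similarly for `ζ'`, so the product telescopes to
`B (kω) (mω)`, a power of `B 0 ω`. -/
theorem mul_eq_zpow_of_translation_invariant {B : ℂ → ℂ → G} {ω : ℂ}
    (hmul : ∀ ζ ζ' ζ'', B ζ ζ' * B ζ' ζ'' = B ζ ζ'')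
    (htr : ∀ (k : ℤ) ζ ζ', B (ζ + k * ω) (ζ' + k * ω) = B ζ ζ') (ζ ζ' : ℂ) (k m : ℤ) :
    B 0 ζ * B (ζ + k * ω) (ζ' + m * ω) * (B 0 ζ')⁻¹ = B 0 ω ^ (m - k) := by
  have hgen : ∀ k : ℤ, B 0 (k * ω) = B 0 ω ^ k := by
    intro k
    induction k using Int.induction_on with
    | zero => simpa using hmul 0 0 0
    | succ i ih =>
      have h := htr i 0 ω
      rw [zero_add] at h
      rw [zpow_add_one, ← ih, ← h, hmul]
      congr 1
      push_cast
      ring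
    | pred i ih =>
      have h := htr (-i - 1) 0 ω
      rw [zero_add] at h
      rw [zpow_sub_one, ← ih, eq_mul_inv_iff_mul_eq, ← h, hmul]
      congr 1
      push_cast
      ring
  have h1 := htr k 0 ζ
  have h2 := htr m 0 ζ'
  have h3 := htr k 0 ((m - k : ℤ) * ω)
  have h4 : ((m - k : ℤ) : ℂ) * ω + k * ω = m * ω := by
    push_cast
    ring
  rw [zero_add] at h1 h2 h3
  rw [h4] at h3
  rw [← h1, ← h2, hmul, mul_inv_eq_iff_eq_mul, ← hgen, ← h3, hmul]

/-- On the image of a map `E` of the plane, whose deck group is generated by one translation, a path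
cocycle takes values, up to a coboundary, in a cyclic group. -/
theorem exists_local_generator (E : C(ℂ, X)) (ω : ℂ) (hω : ∀ ζ, E (ζ + ω) = E ζ)
    (hE : ∀ ζ ζ', E ζ = E ζ' → ∃ k : ℤ, ζ' = ζ + k * ω) {U : Set X}
    (hU : ∀ {a b : X} (δ : Path a b), (∀ t, δ t ∈ U) → ∃ L : C(I, ℂ), ∀ t, E (L t) = δ t) :
    ∃ (s : X → G) (T : Set G), T.Finite ∧ ∀ (a b : X) (δ : Path a b), (∀ t, δ t ∈ U) →
      s a * Θ.val δ * (s b)⁻¹ ∈ Subgroup.closure T := by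
  -- As the plane is simply connected, the value on the image of a path depends only on the end
  -- points in the plane.
  obtain ⟨B, hB⟩ : ∃ B : ℂ → ℂ → G, ∀ {ζ ζ' : ℂ} (γ : Path ζ ζ'),
      Θ.val (γ.map E.continuous) = B ζ ζ' :=
    ⟨fun ζ ζ' => Θ.val ((PathConnectedSpace.somePath ζ ζ').map E.continuous), fun γ =>
      Θ.map_homotopic ((SimplyConnectedSpace.paths_homotopic _ _).map E)⟩
  have hmul : ∀ ζ ζ' ζ'', B ζ ζ' * B ζ' ζ'' = B ζ ζ'' := by
    intro ζ ζ' ζ''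
    rw [← hB ((PathConnectedSpace.somePath ζ ζ').trans (PathConnectedSpace.somePath ζ' ζ'')),
      Path.map_trans, Θ.map_trans, hB, hB]
  have hωn : ∀ (k : ℤ) ζ, E (ζ + k * ω) = E ζ := by
    intro k
    induction k using Int.induction_on with
    | zero => simp
    | succ i ih =>
      intro ζ
      rw [← ih ζ, ← hω (ζ + (i : ℤ) * ω)]
      congr 1
      push_cast
      ring
    | pred i ih =>
      intro ζ
      rw [← hω (ζ + _), ← ih ζ]
      congr 1
      push_cast
      ring
  have htr : ∀ (k : ℤ) ζ ζ', B (ζ + k * ω) (ζ' + k * ω) = B ζ ζ' := by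
    intro k ζ ζ'
    have h := hB ((PathConnectedSpace.somePath ζ ζ').map (f := fun z => z + k * ω) (by fun_prop))
    refine h.symm.trans (Eq.trans ?_ (hB (PathConnectedSpace.somePath ζ ζ')))
    exact Θ.map_congr fun t => hωn k (PathConnectedSpace.somePath ζ ζ' t)
  obtain ⟨ξ, hξ⟩ : ∃ ξ : X → ℂ, ∀ ζ, ∃ k : ℤ, ζ = ξ (E ζ) + k * ω :=
    ⟨Function.invFun E, fun ζ => hE _ _ (Function.invFun_eq ⟨ζ, rfl⟩)⟩
  refine ⟨fun y => B 0 (ξ y), {B 0 ω}, finite_singleton _, fun a b δ hδ => ?_⟩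
  obtain ⟨L, hL⟩ := hU δ hδ
  obtain ⟨k, hk⟩ := hξ (L 0)
  obtain ⟨m, hm⟩ := hξ (L 1)
  rw [hL, δ.source] at hk
  rw [hL, δ.target] at hm
  have hδ : Θ.val δ = B (ξ a + k * ω) (ξ b + m * ω) := by
    rw [← hB ⟨L, hk, hm⟩]
    exact Θ.map_congr (δ := Path.map ⟨L, hk, hm⟩ E.continuous) fun t => (hL t).symm
  rw [hδ, mul_eq_zpow_of_translation_invariant hmul htr]
  exact Subgroup.zpow_mem _ (Subgroup.subset_closure (mem_singleton _)) _

/-- A loop is cut into pieces lying in single sets `V k`. Normalised by `s k`, each piece lies in a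
finitely generated subgroup. Passing from `s i` to `s j` costs a factor that, up to the local
subgroups, is constant on each path connected `Q`, so finitely many transition elements suffice. -/
theorem group_fg_of_cover {x₀ : X} (hsurj : ∀ g, ∃ γ : Path x₀ x₀, Θ.val γ = g)
    {ι : Type*} [Finite ι] {U V : ι → Set X} (hV : ∀ i, IsOpen (V i)) (hVU : ∀ i, V i ⊆ U i)
    (hcov : ∀ x, ∃ i, x ∈ V i)
    (hloc : ∀ i, ∃ (s : X → G) (T : Set G), T.Finite ∧ ∀ (a b : X) (δ : Path a b),
      (∀ t, δ t ∈ U i) → s a * Θ.val δ * (s b)⁻¹ ∈ Subgroup.closure T)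
    (hQ : ∀ i j, ∃ 𝒬 : Set (Set X), 𝒬.Finite ∧
      (∀ Q ∈ 𝒬, IsPathConnected Q ∧ Q ⊆ U i ∧ Q ⊆ U j) ∧ V i ∩ V j ⊆ ⋃₀ 𝒬) :
    Group.FG G := by
  classical
  choose s T hT hs using hloc
  choose 𝒬 hQf hQc hQV using hQ
  have hy : ∀ Q : Set X, ∃ y, Q.Nonempty → y ∈ Q := fun Q => by
    by_cases h : Q.Nonempty
    · exact ⟨h.some, fun _ => h.some_mem⟩
    · exact ⟨x₀, fun h' => absurd h' h⟩
  choose y hy using hy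
  -- The generators: the local ones, and one transition element for each piece of each overlap,
  -- taken at a chosen point.
  let A : Set G := (⋃ i, T i) ∪ ⋃ i, ⋃ j, (fun Q => s i (y Q) * (s j (y Q))⁻¹) '' 𝒬 i j
  have hA : A.Finite :=
    (finite_iUnion hT).union (finite_iUnion fun i => finite_iUnion fun j => (hQf i j).image _)
  let H := Subgroup.closure A
  have hTH : ∀ i, Subgroup.closure (T i) ≤ H := fun i =>
    Subgroup.closure_mono ((subset_iUnion T i).trans subset_union_left)
  have hchange : ∀ i j b, b ∈ V i → b ∈ V j → s i b * (s j b)⁻¹ ∈ H := by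
    intro i j b hbi hbj
    obtain ⟨Q, hQ, hbQ⟩ := hQV i j ⟨hbi, hbj⟩
    obtain ⟨hpc, hQi, hQj⟩ := hQc i j Q hQ
    obtain ⟨ρ, hρ⟩ := hpc.joinedIn (y Q) (hy Q ⟨b, hbQ⟩) b hbQ
    have h1 := hTH i (hs i _ _ ρ fun t => hQi (hρ t))
    have h2 := hTH j (hs j _ _ ρ fun t => hQj (hρ t))
    have h3 : s i (y Q) * (s j (y Q))⁻¹ ∈ H := Subgroup.subset_closure
      (Or.inr (mem_iUnion₂.mpr ⟨i, j, Q, hQ, rfl⟩))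
    have := H.mul_mem (H.mul_mem (H.inv_mem h1) h3) h2
    convert this using 1
    group
  have hpath : ∀ (γ : Path x₀ x₀) i, x₀ ∈ V i → s i x₀ * Θ.val γ * (s i x₀)⁻¹ ∈ H := by
    intro γ i hi
    obtain ⟨t, ht0, htm, ⟨N, hN⟩, hti⟩ := exists_monotone_Icc_subset_open_cover_unitInterval
      (c := fun i => γ ⁻¹' V i) (fun i => (hV i).preimage γ.continuous)
      (fun u _ => mem_iUnion.mpr (hcov (γ u)))
    have key : ∀ n j, γ (t n) ∈ V j →
        s i (γ 0) * Θ.val (γ.subpath 0 (t n)) * (s j (γ (t n)))⁻¹ ∈ H := by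
      intro n
      induction n with
      | zero =>
        intro j hj
        rw [ht0] at hj ⊢
        rw [Path.subpath_self, Θ.map_refl, mul_one]
        exact hchange i j _ (by simpa using hi) hj
      | succ n ih =>
        intro j hj
        obtain ⟨k, hk⟩ := hti n
        have hle : t n ≤ t (n + 1) := htm n.le_succ
        have h1 := ih k (hk ⟨le_rfl, hle⟩)
        have h2 := hTH k (hs k _ _ (γ.subpath (t n) (t (n + 1))) fun u => hVU k (by
          have : γ.subpath (t n) (t (n + 1)) u ∈ range (γ.subpath (t n) (t (n + 1))) := ⟨u, rfl⟩
          rw [Path.range_subpath_of_le _ _ _ hle] at this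
          obtain ⟨v, hv, hv'⟩ := this
          rw [← hv']
          exact hk hv))
        have h3 := hchange k j _ (hk ⟨hle, le_rfl⟩) hj
        have h4 := Θ.map_homotopic ⟨Path.Homotopy.subpathTransSubpath γ 0 (t n) (t (n + 1))⟩
        rw [Θ.map_trans] at h4
        rw [← h4]
        convert H.mul_mem (H.mul_mem h1 h2) h3 using 1
        group
    have hfin := key N i (by rw [hN N le_rfl]; simpa using hi)
    rw [hN N le_rfl] at hfin
    have h0 : Θ.val (γ.subpath 0 1) = Θ.val γ := by
      rw [Path.subpath_zero_one]
      exact Θ.map_congr fun t => rfl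
    rwa [h0, γ.source, γ.target] at hfin
  obtain ⟨i, hi⟩ := hcov x₀
  have hH : H = ⊤ := by
    rw [eq_top_iff]
    intro g _
    obtain ⟨γ, hγ⟩ := hsurj ((s i x₀)⁻¹ * g * s i x₀)
    have := hpath γ i hi
    rw [hγ] at this
    convert this using 1
    group
  exact ⟨⟨hA.toFinset, by simpa using hH⟩⟩

end PathCocycle

end PathCocycle

section FiniteGeneration

variable {S : Type*} [TopologicalSpace S]

/-- A punctured disc is covered by the plane through the exponential, with period `2πi`; an
unpunctured disc is parametrised by the plane itself, with period `0`. -/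
theorem PathCocycle.exists_local_generator_punctured {P : Finset S} {G : Type*} [Group G]
    (Θ : PathCocycle (Punctured S P) G) {c : OpenPartialHomeomorph S ℂ} (hc : c.target = univ)
    {y : S} (hy : y ∈ c.source) (hy0 : c y = 0) (hP : ∀ r ∈ P, r ∈ c.source → r = y) :
    ∃ (s : Punctured S P → G) (T : Set G), T.Finite ∧
      ∀ (a b : Punctured S P) (δ : Path a b), (∀ t, (δ t : S) ∈ c.source) →
        s a * Θ.val δ * (s b)⁻¹ ∈ Subgroup.closure T := by
  have hs := continuous_symm_of_target_univ hc
  have hcδ : ∀ {a b : Punctured S P} (δ : Path a b), (∀ t, (δ t : S) ∈ c.source) →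
      Continuous fun t => c (δ t) := fun δ hδ =>
    c.continuousOn.comp_continuous (continuous_subtype_val.comp δ.continuous) hδ
  by_cases hyP : y ∈ P
  · have hE : ∀ ζ, c.symm (Complex.exp ζ) ∉ P := by
      intro ζ h
      have h1 := hP _ h (symm_mem_source_of_target_univ hc _)
      have h2 := right_inv_of_target_univ hc (Complex.exp ζ)
      rw [h1, hy0] at h2
      exact Complex.exp_ne_zero _ h2.symm
    refine Θ.exists_local_generator (U := {x | (x : S) ∈ c.source})
      ⟨fun ζ => ⟨c.symm (Complex.exp ζ), hE ζ⟩, by fun_prop⟩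
      (2 * Real.pi * Complex.I) (fun ζ => ?_) (fun ζ ζ' h => ?_) (fun {a b} δ hδ => ?_)
    · simp [Complex.exp_periodic ζ]
    · have := injective_symm_of_target_univ hc (congrArg Subtype.val h)
      exact Complex.exp_eq_exp_iff_exists_int.mp this.symm
    · obtain ⟨L, hL⟩ := exists_continuousMap_log (A := I) ⟨_, hcδ δ hδ⟩ (fun t h => by
        have h1 : c (δ t) = c y := by rw [hy0]; exact h
        exact (δ t).2 (c.injOn (hδ t) hy h1 ▸ hyP))
      refine ⟨L, fun t => Subtype.ext ?_⟩
      change c.symm (Complex.exp (L t)) = _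
      rw [hL]
      exact c.left_inv (hδ t)
  · have hE : ∀ ζ, c.symm ζ ∉ P := fun ζ h =>
      hyP (hP _ h (symm_mem_source_of_target_univ hc _) ▸ h)
    refine Θ.exists_local_generator (U := {x | (x : S) ∈ c.source})
      ⟨fun ζ => ⟨c.symm ζ, hE ζ⟩, by fun_prop⟩ 0 (by simp) (fun ζ ζ' h => ⟨0, ?_⟩)
      (fun {a b} δ hδ => ⟨⟨_, hcδ δ hδ⟩, fun t => Subtype.ext (c.left_inv (hδ t))⟩)
    simpa using (injective_symm_of_target_univ hc (congrArg Subtype.val h)).symm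

/-- The fundamental group of a punctured closed surface is finitely generated. -/
theorem fundamentalGroup_punctured_fg [T2Space S] [CompactSpace S] [ChartedSpace ℂ S]
    (P : Finset S) [ConnectedSpace (Punctured S P)] (x₀ : Punctured S P) :
    Group.FG (FundamentalGroup (Punctured S P) x₀) := by
  have hex : ∀ y : S, ∃ c : OpenPartialHomeomorph S ℂ, c.target = univ ∧ y ∈ c.source ∧
      c y = 0 ∧ ∀ r ∈ P, r ∈ c.source → r = y := by
    intro y
    have hO : IsOpen ((P : Set S) \ {y})ᶜ :=
      (P.finite_toSet.subset sdiff_subset).isClosed.isOpen_compl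
    obtain ⟨c, hc, hyc, hcO, hc0⟩ := exists_chart_target_univ hO (y := y) (by simp)
    refine ⟨c, hc, hyc, hc0, fun r hr hrc => ?_⟩
    by_contra hne
    exact hcO hrc ⟨hr, hne⟩
  choose c hc hyc hc0 hcP using hex
  let W : S → Set S := fun y => (c y).source ∩ c y ⁻¹' Metric.ball 0 1
  have hWo : ∀ y, IsOpen (W y) := fun y => (c y).isOpen_inter_preimage Metric.isOpen_ball
  have hWy : ∀ y, y ∈ W y := fun y => ⟨hyc y, by simp [hc0]⟩
  obtain ⟨t, ht⟩ := isCompact_univ.elim_nhds_subcover W fun y _ => (hWo y).mem_nhds (hWy y)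
  let C : S → Set S := fun y => (c y).symm '' Metric.closedBall 0 1
  have hC : ∀ y, IsCompact (C y) := fun y =>
    (isCompact_closedBall (0 : ℂ) 1).image (continuous_symm_of_target_univ (hc y))
  have hCs : ∀ y, C y ⊆ (c y).source := by
    rintro y _ ⟨z, -, rfl⟩
    exact symm_mem_source_of_target_univ (hc y) z
  have hWC : ∀ y, W y ⊆ C y := fun y x hx =>
    ⟨c y x, Metric.ball_subset_closedBall hx.2, (c y).left_inv hx.1⟩
  refine (PathCocycle.ofPathConnected x₀).group_fg_of_cover (ι := t)
    (PathCocycle.ofPathConnected_surjective x₀)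
    (U := fun y => {x | (x : S) ∈ (c y).source}) (V := fun y => {x | (x : S) ∈ W y})
    (fun y => (hWo y).preimage continuous_subtype_val) (fun y x hx => hx.1) (fun x => ?_)
    (fun y => ?_) (fun y y' => ?_)
  · obtain ⟨y, hy, hxy⟩ := mem_iUnion₂.mp (ht.2 (mem_univ (x : S)))
    exact ⟨⟨y, hy⟩, hxy⟩
  · exact PathCocycle.exists_local_generator_punctured _ (hc y) (hyc y) (hc0 y) (hcP y)
  · have hO : IsOpen ((c y).source ∩ (c y').source) := (c y).open_source.inter (c y').open_source
    -- Two chart domains may overlap in infinitely many components, but the compact overlap of the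
    -- closed unit discs is covered by finitely many small discs.
    have hd : ∀ w : S, ∃ d : OpenPartialHomeomorph S ℂ, w ∈ C y ∩ C y' →
        d.target = univ ∧ w ∈ d.source ∧ d.source ⊆ (c y).source ∩ (c y').source := by
      intro w
      by_cases hw : w ∈ C y ∩ C y'
      · obtain ⟨d, h1, h2, h3, -⟩ := exists_chart_target_univ hO ⟨hCs _ hw.1, hCs _ hw.2⟩
        exact ⟨d, fun _ => ⟨h1, h2, h3⟩⟩
      · exact ⟨c y, fun h => absurd h hw⟩
    choose d hd using hd
    obtain ⟨u, huC, hu⟩ := ((hC y).inter (hC y')).elim_nhds_subcover (fun w => (d w).source)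
      fun w hw => (d w).open_source.mem_nhds (hd w hw).2.1
    refine ⟨(fun w => {x : Punctured S P | (x : S) ∈ (d w).source}) '' u,
      u.finite_toSet.image _, ?_, ?_⟩
    · rintro _ ⟨w, hw, rfl⟩
      obtain ⟨h1, -, h3⟩ := hd w (huC w hw)
      exact ⟨isPathConnected_source_punctured h1 P, fun x hx => (h3 hx).1, fun x hx => (h3 hx).2⟩
    · rintro x ⟨hx, hx'⟩
      obtain ⟨w, hw, hxw⟩ := mem_iUnion₂.mp (hu ⟨hWC _ hx, hWC _ hx'⟩)
      exact ⟨_, ⟨w, hw, rfl⟩, hxw⟩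

end FiniteGeneration

/-! ### A characteristic subgroup of finite index -/

section Characteristic

/-- The intersection of the kernels of all homomorphisms to `A`. -/
def commonKernel (G A : Type*) [Group G] [Group A] : Subgroup G :=
  ⨅ φ : G →* A, φ.ker

theorem commonKernel_characteristic (G A : Type*) [Group G] [Group A] :
    (commonKernel G A).Characteristic := by
  rw [Subgroup.characteristic_iff_le_comap]
  intro ψ g hg
  simp only [commonKernel, Subgroup.mem_iInf, MonoidHom.mem_ker, Subgroup.mem_comap] at hg ⊢
  exact fun φ => hg (φ.comp ψ.toMonoidHom)

theorem finite_monoidHom_of_fg (G A : Type*) [Group G] [Group A] [Finite A] (hG : Group.FG G) :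
    Finite (G →* A) := by
  obtain ⟨s, hs⟩ := hG.out
  refine Finite.of_injective (fun (φ : G →* A) (x : s) => φ x) fun φ ψ h => ?_
  exact MonoidHom.eq_of_eqOn_dense hs fun x hx => congrFun h ⟨x, hx⟩

/-- A homomorphism is determined by its values on finitely many generators, so only finitely many
kernels of finite index are intersected. -/
theorem commonKernel_finiteIndex (G A : Type*) [Group G] [Group A] [Finite A] (hG : Group.FG G) :
    (commonKernel G A).FiniteIndex := by
  have := finite_monoidHom_of_fg G A hG
  exact Subgroup.finiteIndex_iInf fun φ => inferInstance

/-- An automorphism that is inner modulo the common kernel of the homomorphisms to a commutative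
group does not change such homomorphisms. -/
theorem map_eq_of_outQuotient_eq_one {G A : Type*} [Group G] [CommGroup A] {K : Subgroup G}
    [K.Characteristic] (hK : K ≤ commonKernel G A) {ψ : MulAut G}
    (h : outQuotient K (QuotientGroup.mk ψ) = 1) (φ : G →* A) (α : G) : φ (ψ α) = φ α := by
  have h' : (QuotientGroup.mk (autQuotient K ψ) : Out (G ⧸ K)) = 1 := h
  rw [QuotientGroup.eq_one_iff] at h'
  obtain ⟨g, hg⟩ := h'
  obtain ⟨g, rfl⟩ := QuotientGroup.mk_surjective g
  have h1 := DFunLike.congr_fun hg (α : G ⧸ K)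
  have h2 : ((g * α * g⁻¹ : G) : G ⧸ K) = (ψ α : G) := h1
  have h3 := hK (QuotientGroup.eq.mp h2)
  simp only [commonKernel, Subgroup.mem_iInf, MonoidHom.mem_ker] at h3
  -- `φ` kills `K` and has commutative target, so the conjugation by `g` disappears.
  have h4 := h3 φ
  rw [map_mul, map_inv, inv_mul_eq_one] at h4
  rw [← h4]
  simp [mul_comm]

end Characteristic

/-! ### Winding numbers of a map to the punctured plane -/

section LogIncrement

variable {X : Type*} [TopologicalSpace X] {u : C(X, ℂ)} (hu : ∀ x, u x ≠ 0)

theorem exists_log_along {u : C(X, ℂ)} (hu : ∀ x, u x ≠ 0) (γ : C(I, X)) : ∃ L : C(I, ℂ), ∀ t, Complex.exp (L t) = u (γ t) :=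
  exists_continuousMap_log (u.comp γ) fun t => hu (γ t)

theorem log_increment_unique {Y : Type*} [TopologicalSpace Y] [PreconnectedSpace Y] {L M : C(Y, ℂ)}
    (h : ∀ t, Complex.exp (L t) = Complex.exp (M t)) (s t : Y) : L t - L s = M t - M s := by
  obtain ⟨n, hn⟩ := isPreconnected_univ.exists_int_of_exp_eq L.continuous.continuousOn
    M.continuous.continuousOn fun t _ => h t
  rw [hn t trivial, hn s trivial]
  ring

/-- The increment of a continuous logarithm of `u` along paths. -/
def logIncrement : PathCocycle X (Multiplicative ℂ) where
  val γ := .ofAdd ((exists_log_along hu γ).choose 1 - (exists_log_along hu γ).choose 0)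
  map_trans {a b c} γ δ := by
    rw [← ofAdd_add]
    congr 1
    have h := (exists_log_along hu (γ.trans δ)).choose_spec
    set L := (exists_log_along hu (γ.trans δ)).choose
    -- A logarithm along the concatenation restricts, via `l` and `r`, to logarithms along its two
    -- halves.
    let l : C(I, I) := ⟨fun t => ⟨t / 2, by constructor <;> linarith [t.2.1, t.2.2]⟩, by fun_prop⟩
    let r : C(I, I) :=
      ⟨fun t => ⟨(1 + t) / 2, by constructor <;> linarith [t.2.1, t.2.2]⟩, by fun_prop⟩
    have h1 := log_increment_unique (L := (exists_log_along hu γ).choose) (M := L.comp l)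
      (fun t => by
        rw [(exists_log_along hu γ).choose_spec, ContinuousMap.comp_apply, h]
        congr 1
        have ht : ((l t : I) : ℝ) ≤ 1 / 2 := by
          change (t : ℝ) / 2 ≤ 1 / 2
          linarith [t.2.2]
        change γ t = γ.trans δ (l t)
        rw [Path.trans_apply, dif_pos ht]
        congr 1
        ext
        change (t : ℝ) = 2 * (t / 2)
        ring) 0 1
    have h2 := log_increment_unique (L := (exists_log_along hu δ).choose) (M := L.comp r)
      (fun t => by
        rw [(exists_log_along hu δ).choose_spec, ContinuousMap.comp_apply, h]
        congr 1
        have hrt : ((r t : I) : ℝ) = (1 + t) / 2 := rfl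
        change δ t = γ.trans δ (r t)
        -- At `t = 0` the midpoint is assigned to the first half by `Path.trans`, hence the separate
        -- case.
        by_cases ht : ((r t : I) : ℝ) ≤ 1 / 2
        · have h0 : t = 0 := by
            ext
            change (t : ℝ) = 0
            linarith [t.2.1]
          have hr0 : r t = ⟨1 / 2, by norm_num, by norm_num⟩ := by
            ext
            rw [hrt, h0]
            norm_num
          rw [hr0, Path.trans_apply, dif_pos (by norm_num), h0, δ.source]
          symm
          convert γ.target
          norm_num
        · rw [Path.trans_apply, dif_neg ht]
          congr 1
          ext
          change (t : ℝ) = 2 * (r t) - 1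
          rw [hrt]
          ring) 0 1
    rw [h1, h2]
    have e1 : l 1 = r 0 := by
      ext
      change (1 : ℝ) / 2 = (1 + 0) / 2
      ring
    have e2 : l 0 = 0 := by
      ext
      change (0 : ℝ) / 2 = 0
      ring
    have e3 : r 1 = 1 := by
      ext
      change ((1 : ℝ) + 1) / 2 = 1
      ring
    simp only [ContinuousMap.comp_apply, e1, e2, e3]
    ring
  map_homotopic {a b γ δ} h := by
    obtain ⟨H⟩ := h
    congr 1
    obtain ⟨L, hL⟩ := exists_continuousMap_log (u.comp H.toContinuousMap) fun t => hu _
    -- The homotopy fixes the end points of the paths, so a logarithm on the square is constant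
    -- along those two sides.
    have hside : ∀ t : I, (∀ s, H (s, t) = H (0, t)) → L (1, t) = L (0, t) := by
      intro t ht
      have := log_increment_unique (Y := I) (L := L.comp ⟨fun s => (s, t), by fun_prop⟩)
        (M := .const I (L (0, t))) (fun s => by
          simp only [ContinuousMap.comp_apply, ContinuousMap.coe_mk, ContinuousMap.const_apply, hL]
          exact congrArg u (ht s)) 0 1
      simpa [sub_eq_zero] using this
    have h0 := hside 0 fun s => by simp
    have h1 := hside 1 fun s => by simp
    have hγ := log_increment_unique (L := (exists_log_along hu γ).choose)
      (M := L.comp ⟨fun t => (0, t), by fun_prop⟩) (fun t => by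
        rw [(exists_log_along hu γ).choose_spec]
        simp only [ContinuousMap.comp_apply, ContinuousMap.coe_mk, hL]
        exact congrArg u (H.apply_zero t).symm) 0 1
    have hδ := log_increment_unique (L := (exists_log_along hu δ).choose)
      (M := L.comp ⟨fun t => (1, t), by fun_prop⟩) (fun t => by
        rw [(exists_log_along hu δ).choose_spec]
        simp only [ContinuousMap.comp_apply, ContinuousMap.coe_mk, hL]
        exact congrArg u (H.apply_one t).symm) 0 1
    rw [hγ, hδ]
    simp [h0, h1]

theorem logIncrement_eq {a b : X} (γ : Path a b) {L : C(I, ℂ)}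
    (hL : ∀ t, Complex.exp (L t) = u (γ t)) :
    (logIncrement hu).val γ = .ofAdd (L 1 - L 0) :=
  congrArg Multiplicative.ofAdd (log_increment_unique
    (L := (exists_log_along hu γ).choose) (M := L) (fun t => by
      rw [hL]
      exact (exists_log_along hu γ).choose_spec t) 0 1)

theorem logIncrement_eq_of_hasWinding {a : X} (γ : Path a a) {ℓ : ℝ → ℂ} {n : ℤ}
    (hℓ : HasWinding ℓ n) (h : ∀ t : I, u (γ t) = ℓ (2 * Real.pi * t)) :
    (logIncrement hu).val γ = .ofAdd (n * (2 * Real.pi * Complex.I)) := by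
  obtain ⟨L, hL, he, hn⟩ := hℓ
  rw [logIncrement_eq hu γ (L := ⟨fun t : I => L (2 * Real.pi * t), by fun_prop⟩)
    (fun t => by rw [h, ← he]; rfl)]
  congr 1
  have := hn 0
  simp only [zero_add] at this
  simp [this]

theorem exists_int_logIncrement {a : X} (γ : Path a a) :
    ∃ n : ℤ, (logIncrement hu).val γ = .ofAdd (n * (2 * Real.pi * Complex.I)) := by
  obtain ⟨L, hL⟩ := exists_log_along hu γ
  have h : Complex.exp (L 1) = Complex.exp (L 0) := by
    rw [hL, hL]
    simp
  obtain ⟨n, hn⟩ := Complex.exp_eq_exp_iff_exists_int.mp h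
  exact ⟨n, by rw [logIncrement_eq hu γ hL, hn]; simp⟩

/-- The increment of a continuous logarithm of `u` along a homotopy class of paths. -/
def logIncrementHom {a b : X} (g : FundamentalGroupoid.mk a ⟶ FundamentalGroupoid.mk b) :
    Multiplicative ℂ :=
  Quotient.lift (logIncrement hu).val (fun _ _ h => (logIncrement hu).map_homotopic h) g

theorem logIncrementHom_mk {a b : X} (γ : Path a b) :
    logIncrementHom hu (FundamentalGroupoid.fromPath (.mk γ)) = (logIncrement hu).val γ :=
  rfl

theorem logIncrementHom_comp {a b c : X} (g : FundamentalGroupoid.mk a ⟶ FundamentalGroupoid.mk b)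
    (h : FundamentalGroupoid.mk b ⟶ FundamentalGroupoid.mk c) :
    logIncrementHom hu (g ≫ h) = logIncrementHom hu g * logIncrementHom hu h := by
  obtain ⟨γ, rfl⟩ := Path.Homotopic.Quotient.mk_surjective g
  obtain ⟨δ, rfl⟩ := Path.Homotopic.Quotient.mk_surjective h
  exact (logIncrement hu).map_trans γ δ

/-- The target is commutative: the contributions of `g` and its inverse cancel, so base points and
connecting paths do not matter. -/
theorem logIncrementHom_conj {a b : X} (g : FundamentalGroupoid.mk a ⟶ FundamentalGroupoid.mk b)
    (h : FundamentalGroupoid.mk b ⟶ FundamentalGroupoid.mk b) :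
    logIncrementHom hu (g ≫ h ≫ Groupoid.inv g) = logIncrementHom hu h := by
  have h1 := logIncrementHom_comp hu (g ≫ h ≫ Groupoid.inv g) g
  have h2 : (g ≫ h ≫ Groupoid.inv g) ≫ g = g ≫ h := by simp
  rw [h2, logIncrementHom_comp, mul_comm] at h1
  exact (mul_right_cancel h1).symm

theorem exists_int_logIncrementHom {x₀ : X} (α : FundamentalGroup X x₀) :
    ∃ n : ℤ, logIncrementHom hu α = .ofAdd (n * (2 * Real.pi * Complex.I)) := by
  obtain ⟨γ, rfl⟩ := Path.Homotopic.Quotient.mk_surjective α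
  exact exists_int_logIncrement hu γ

theorem int_eq_of_ofAdd_two_pi_I {m n : ℤ}
    (h : Multiplicative.ofAdd (m * (2 * Real.pi * Complex.I) : ℂ) =
      .ofAdd (n * (2 * Real.pi * Complex.I) : ℂ)) : m = n :=
  int_eq_of_add_mul_two_pi_I (z := 0) (by simpa using h)

/-- The homomorphism `π₁(X, x₀) → ℤ` induced by a map `u` to the punctured plane. -/
def windingHom (x₀ : X) : FundamentalGroup X x₀ →* Multiplicative ℤ :=
  MonoidHom.mk' (fun α => .ofAdd (exists_int_logIncrementHom hu α).choose) fun α β => by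
    rw [← ofAdd_add]
    congr 1
    apply int_eq_of_ofAdd_two_pi_I
    rw [← (exists_int_logIncrementHom hu (α * β)).choose_spec, Int.cast_add, add_mul, ofAdd_add,
      ← (exists_int_logIncrementHom hu α).choose_spec,
      ← (exists_int_logIncrementHom hu β).choose_spec, End.mul_def, logIncrementHom_comp, mul_comm]

theorem windingHom_eq {x₀ : X} {α : FundamentalGroup X x₀} {n : ℤ}
    (h : logIncrementHom hu α = .ofAdd (n * (2 * Real.pi * Complex.I))) :
    windingHom hu x₀ α = .ofAdd n := by
  change Multiplicative.ofAdd _ = _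
  congr 1
  apply int_eq_of_ofAdd_two_pi_I
  rw [← (exists_int_logIncrementHom hu α).choose_spec, h]

end LogIncrement

/-! ### Orientation-preserving homeomorphisms have local degree one -/

section Orientation

variable {X : Type*} [TopologicalSpace X] {c d e : OpenPartialHomeomorph X ℂ} {x : X}

theorem transition_mem_nhds (hxc : x ∈ c.source) (hxd : x ∈ d.source) :
    (c.symm.trans d).source ∈ 𝓝 (c x) :=
  (c.symm.trans d).open_source.mem_nhds (by simp [hxc, hxd])

theorem exists_hasLocalDegree_transition (hxc : x ∈ c.source) (hxd : x ∈ d.source) :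
    ∃ n, HasLocalDegree (fun z => d (c.symm z)) (c x) n :=
  exists_hasLocalDegree (transition_mem_nhds hxc hxd) (c.symm.trans d).continuousOn
    (c.symm.trans d).injOn

theorem OrientationCompatible.hasLocalDegree (h : OrientationCompatible c d) (hxc : x ∈ c.source)
    (hxd : x ∈ d.source) : HasLocalDegree (fun z => d (c.symm z)) (c x) 1 :=
  (h x ⟨hxc, hxd⟩).hasLocalDegree (transition_mem_nhds hxc hxd) (c.symm.trans d).continuousOn
    (c.symm.trans d).injOn

theorem HasLocalDegree.transition_trans {m n : ℤ} (hxc : x ∈ c.source) (hxd : x ∈ d.source)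
    (h : HasLocalDegree (fun z => d (c.symm z)) (c x) m)
    (h' : HasLocalDegree (fun z => e (d.symm z)) (d x) n) :
    HasLocalDegree (fun z => e (c.symm z)) (c x) (n * m) := by
  have h1 := h.comp (h := fun z => e (d.symm z)) (n := n) (by rwa [c.left_inv hxc])
  refine h1.congr ?_
  filter_upwards [transition_mem_nhds hxc hxd] with z hz
  rw [OpenPartialHomeomorph.trans_source] at hz
  exact congrArg e (d.left_inv hz.2)

theorem hasLocalDegree_transition_self (hxc : x ∈ c.source) :
    HasLocalDegree (fun z => c (c.symm z)) (c x) 1 := by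
  refine (HasLocalDegree.id (c x)).congr ?_
  filter_upwards [c.open_target.mem_nhds (c.map_source hxc)] with z hz
  exact (c.right_inv hz).symm

theorem HasLocalDegree.eventually_transition {n : ℤ} (hxc : x ∈ c.source)
    (h : HasLocalDegree (fun z => d (c.symm z)) (c x) n) :
    ∀ᶠ y in 𝓝 x, HasLocalDegree (fun z => d (c.symm z)) (c y) n :=
  (c.continuousAt hxc).eventually h.eventually

/-- The degree of an arbitrary chart with respect to the positively oriented charts is constant on
a connected domain. -/
theorem SurfaceOrientation.exists_hasLocalDegree (o : SurfaceOrientation X)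
    (hc : IsPreconnected c.source) : ∃ n : ℤ, ∀ x ∈ c.source, ∀ d ∈ o.charts, x ∈ d.source →
      HasLocalDegree (fun z => d (c.symm z)) (c x) n := by
  rcases c.source.eq_empty_or_nonempty with he | ⟨x₁, hx₁⟩
  · exact ⟨0, by simp [he]⟩
  obtain ⟨d₁, hd₁, hxd₁⟩ := o.covers x₁
  obtain ⟨n, hn⟩ := exists_hasLocalDegree_transition hx₁ hxd₁
  -- Positive charts differ by transitions of degree one, and degrees multiply.
  have hindep : ∀ x ∈ c.source, ∀ d ∈ o.charts, x ∈ d.source → ∀ d' ∈ o.charts, x ∈ d'.source →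
      ∀ m, HasLocalDegree (fun z => d (c.symm z)) (c x) m →
        HasLocalDegree (fun z => d' (c.symm z)) (c x) m := by
    intro x hx d hd hxd d' hd' hxd' m hm
    simpa using hm.transition_trans hx hxd ((o.compatible d hd d' hd').hasLocalDegree hxd hxd')
  let A : ℤ → Set X := fun m => {x | x ∈ c.source ∧ ∃ d ∈ o.charts, x ∈ d.source ∧
    HasLocalDegree (fun z => d (c.symm z)) (c x) m}
  have hA : ∀ m, IsOpen (A m) := by
    intro m
    rw [isOpen_iff_mem_nhds]
    rintro x ⟨hx, d, hd, hxd, hm⟩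
    filter_upwards [c.open_source.mem_nhds hx, d.open_source.mem_nhds hxd,
      hm.eventually_transition hx] with y h1 h2 h3
    exact ⟨h1, d, hd, h2, h3⟩
  have hsub : c.source ⊆ A n := by
    refine hc.subset_left_of_subset_union (hA n) (v := ⋃ m ∈ {m | m ≠ n}, A m)
      (isOpen_biUnion fun m _ => hA m) ?_ ?_ ⟨x₁, hx₁, hx₁, d₁, hd₁, hxd₁, hn⟩
    · refine disjoint_iUnion₂_right.mpr fun m hm => disjoint_left.mpr ?_
      rintro x ⟨hx, d, hd, hxd, h⟩ ⟨-, d', hd', hxd', h'⟩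
      exact hm ((hindep x hx d' hd' hxd' d hd hxd m h').unique h)
    · intro x hx
      obtain ⟨d, hd, hxd⟩ := o.covers x
      obtain ⟨m, hm⟩ := exists_hasLocalDegree_transition hx hxd
      by_cases hmn : m = n
      · exact Or.inl ⟨hx, d, hd, hxd, hmn ▸ hm⟩
      · exact Or.inr (mem_biUnion (show m ∈ {m | m ≠ n} from hmn) ⟨hx, d, hd, hxd, hm⟩)
  refine ⟨n, fun x hx d hd hxd => ?_⟩
  obtain ⟨-, d', hd', hxd', h⟩ := hsub hx
  exact hindep x hx d' hd' hxd' d hd hxd n h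

/-- The chart `c` need not be positive. Its degree `n` against positive charts is constant, and for
a positive `d` near `f x` the chart `d ∘ f` is also positive. So `c ∘ f ∘ c⁻¹` has degree `m * n`,
where `m` is the degree from `d` to `c`, and `m * n = 1`. -/
theorem hasLocalDegree_one_of_mem_homeoPlus {o : SurfaceOrientation X} {f : X ≃ₜ X}
    (hf : f ∈ homeoPlus o) (hc : IsPreconnected c.source) (hx : x ∈ c.source)
    (hfx : f x ∈ c.source) : HasLocalDegree (fun z => c (f (c.symm z))) (c x) 1 := by
  obtain ⟨n, hn⟩ := o.exists_hasLocalDegree hc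
  obtain ⟨d, hd, hxd⟩ := o.covers (f x)
  have hfd : f.transOpenPartialHomeomorph d ∈ o.charts := (hf d).mpr hd
  have h1 := hn x hx _ hfd (by simpa using hxd)
  have h2 := hn (f x) hfx d hd hxd
  obtain ⟨m, hm⟩ := exists_hasLocalDegree_transition hxd hfx
  have hmn : m * n = 1 :=
    (h2.transition_trans hfx hxd hm).unique (hasLocalDegree_transition_self hfx)
  rw [← hmn]
  refine h1.transition_trans (e := f.transOpenPartialHomeomorph c) hx (by simpa using hxd) ?_
  have : (fun z => f.transOpenPartialHomeomorph c ((f.transOpenPartialHomeomorph d).symm z)) =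
      fun z => c (d.symm z) := by
    ext z
    simp
  rw [this]
  simpa using hm

end Orientation

/-! ### Winding numbers about punctures -/

section Puncture

variable {S : Type*} [TopologicalSpace S]

/-- The restriction of a chart of `S` to `S ∖ P`. -/
def puncturedChart [T1Space S] (P : Finset S) [Nonempty (Punctured S P)]
    (c : OpenPartialHomeomorph S ℂ) : OpenPartialHomeomorph (Punctured S P) ℂ :=
  (IsOpenEmbedding.toOpenPartialHomeomorph (Subtype.val : Punctured S P → S)
    (P.finite_toSet.isClosed.isOpen_compl.isOpenEmbedding_subtypeVal)).trans c

section

variable [T1Space S] {P : Finset S} [Nonempty (Punctured S P)] {c : OpenPartialHomeomorph S ℂ}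

theorem puncturedChart_source :
    (puncturedChart P c).source = {x : Punctured S P | (x : S) ∈ c.source} := by
  simp [puncturedChart, preimage]

theorem coe_puncturedChart_symm {z : ℂ} (h : c.symm z ∉ P) :
    ((puncturedChart P c).symm z : S) = c.symm z :=
  (IsOpenEmbedding.toOpenPartialHomeomorph (Subtype.val : Punctured S P → S)
    (P.finite_toSet.isClosed.isOpen_compl.isOpenEmbedding_subtypeVal)).right_inv
      (by simpa using h)

theorem mem_puncturedChart_target (hc : c.target = univ) {z : ℂ} (h : c.symm z ∉ P) :
    z ∈ (puncturedChart P c).target := by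
  simp [puncturedChart, hc, h]

end

section

variable {c : OpenPartialHomeomorph S ℂ}

/-- The map `(c - c p) / (c - c q)`, extended by `1` to the complement of the domain of `c`. -/
def chartQuotient (c : OpenPartialHomeomorph S ℂ) (p q x : S) : ℂ :=
  -- Written as `1` plus a multiple of an inverse, the quotient visibly tends to `1` at infinity.
  open Classical in if x ∈ c.source then 1 + (c q - c p) * (c x - c q)⁻¹ else 1

theorem chartQuotient_of_mem {p q x : S} (hx : x ∈ c.source) (hq : q ∈ c.source) (h : x ≠ q) :
    chartQuotient c p q x = (c x - c p) / (c x - c q) := by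
  have : c x - c q ≠ 0 := sub_ne_zero.mpr fun h' => h (c.injOn hx hq h')
  rw [chartQuotient, if_pos hx]
  field_simp
  ring

theorem chartQuotient_ne_zero {p q x : S} (hp : p ∈ c.source) (hq : q ∈ c.source) (hxp : x ≠ p)
    (hxq : x ≠ q) : chartQuotient c p q x ≠ 0 := by
  by_cases hx : x ∈ c.source
  · rw [chartQuotient_of_mem hx hq hxq]
    exact div_ne_zero (sub_ne_zero.mpr fun h => hxp (c.injOn hx hp h))
      (sub_ne_zero.mpr fun h => hxq (c.injOn hx hq h))
  · rw [chartQuotient, if_neg hx]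
    exact one_ne_zero

end

variable [T2Space S] {P : Finset S} [Nonempty (Punctured S P)] {c : OpenPartialHomeomorph S ℂ}

/-- An orientation-preserving homeomorphism of `S ∖ P` that sends the puncture `p` to the puncture
`q` has local degree one at `p`. -/
theorem hasLocalDegree_update {p q : S} (hq : q ∈ P)
    (hc : c.target = univ) (hpc : p ∈ c.source) (hqc : q ∈ c.source)
    {o : SurfaceOrientation (Punctured S P)} {f : Punctured S P ≃ₜ Punctured S P}
    (hf : f ∈ homeoPlus o) (hfpq : map f (punctureFilter P p) = punctureFilter P q) :
    HasLocalDegree (Function.update (fun z => c (f ((puncturedChart P c).symm z))) (c p) (c q))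
        (c p) 1 ∧
      ∀ᶠ z in 𝓝[≠] (c p), c.symm z ∉ P ∧ (f ((puncturedChart P c).symm z) : S) ∈ c.source := by
  classical
  set c' := puncturedChart P c
  set F : ℂ → ℂ := fun z => c (f (c'.symm z))
  have hs := continuous_symm_of_target_univ hc
  have hnP : ∀ᶠ z in 𝓝[≠] (c p), c.symm z ∉ P := by
    have hfin : (c.symm ⁻¹' (P : Set S) \ {c p}).Finite :=
      (P.finite_toSet.preimage (injective_symm_of_target_univ hc).injOn).subset sdiff_subset
    have h1 := hfin.isClosed.isOpen_compl.mem_nhds (x := c p) (by simp)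
    filter_upwards [mem_nhdsWithin_of_mem_nhds h1, self_mem_nhdsWithin] with z hz hz' hzP
    exact hz ⟨hzP, hz'⟩
  have htend : Tendsto c'.symm (𝓝[≠] (c p)) (punctureFilter P p) := by
    refine tendsto_comap_iff.mpr ?_
    have h1 : Tendsto c.symm (𝓝[≠] (c p)) (𝓝 p) := by
      have := hs.tendsto (c p)
      rw [c.left_inv hpc] at this
      exact this.mono_left nhdsWithin_le_nhds
    refine h1.congr' ?_
    filter_upwards [hnP] with z hz
    exact (coe_puncturedChart_symm hz).symm
  have htendf : Tendsto (fun z => (f (c'.symm z) : S)) (𝓝[≠] (c p)) (𝓝 q) := by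
    have h1 : Tendsto f (punctureFilter P p) (punctureFilter P q) := hfpq.le
    exact tendsto_comap.comp (h1.comp htend)
  have hsrc : ∀ᶠ z in 𝓝[≠] (c p), (f (c'.symm z) : S) ∈ c.source :=
    htendf.eventually (c.open_source.mem_nhds hqc)
  have hF : Tendsto F (𝓝[≠] (c p)) (𝓝 (c q)) := (c.continuousAt hqc).tendsto.comp htendf
  have hgood := hnP.and hsrc
  refine ⟨?_, hgood⟩
  obtain ⟨U, hUo, hpU, hU⟩ := mem_nhdsWithin.mp hgood
  have hU' : ∀ z ∈ U, z ≠ c p → c.symm z ∉ P ∧ (f (c'.symm z) : S) ∈ c.source :=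
    fun z hz hzp => hU ⟨hz, hzp⟩
  have hFc : ∀ z ∈ U, z ≠ c p → ContinuousAt F z := by
    intro z hz hzp
    obtain ⟨h1, h2⟩ := hU' z hz hzp
    have h3 : ContinuousAt c'.symm z := c'.continuousAt_symm (mem_puncturedChart_target hc h1)
    have h4 : ContinuousAt (fun z => (f (c'.symm z) : S)) z :=
      (continuous_subtype_val.comp f.continuous).continuousAt.comp h3
    exact ContinuousAt.comp (g := c) (f := fun z => (f (c'.symm z) : S)) (c.continuousAt h2) h4
  have hne : ∀ z ∈ U, z ≠ c p → F z ≠ c q := by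
    intro z hz hzp h
    exact (f (c'.symm z)).2 (c.injOn (hU' z hz hzp).2 hqc h ▸ hq)
  have hcont : ContinuousOn (Function.update F (c p) (c q)) U := by
    intro z hz
    by_cases hzp : z = c p
    · subst hzp
      exact (continuousAt_update_same.mpr hF).continuousWithinAt
    · exact ((continuousAt_update_of_ne hzp).mpr (hFc z hz hzp)).continuousWithinAt
  have hinj : InjOn (Function.update F (c p) (c q)) U := by
    intro z hz w hw h
    by_cases hzp : z = c p <;> by_cases hwp : w = c p
    · rw [hzp, hwp]
    · rw [hzp, Function.update_self, Function.update_of_ne hwp] at h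
      exact absurd h.symm (hne w hw hwp)
    · rw [hwp, Function.update_self, Function.update_of_ne hzp] at h
      exact absurd h (hne z hz hzp)
    · rw [Function.update_of_ne hzp, Function.update_of_ne hwp] at h
      obtain ⟨h1, h2⟩ := hU' z hz hzp
      obtain ⟨h3, h4⟩ := hU' w hw hwp
      have h5 := f.injective (Subtype.ext (c.injOn h2 h4 h))
      exact c'.symm.injOn (mem_puncturedChart_target hc h1) (mem_puncturedChart_target hc h3) h5
  obtain ⟨n, hn⟩ := exists_hasLocalDegree (hUo.mem_nhds hpU) hcont hinj
  -- The degree at the filled-in point equals the degree at a nearby `z`, where `f` is genuinely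
  -- defined and preserves orientation.
  have hev : ∀ᶠ z in 𝓝[≠] (c p), HasLocalDegree (Function.update F (c p) (c q)) z n ∧ z ∈ U :=
    eventually_nhdsWithin_of_eventually_nhds (hn.eventually.and (hUo.mem_nhds hpU))
  obtain ⟨z, ⟨hzn, hzU⟩, hzp⟩ : ∃ z, (HasLocalDegree (Function.update F (c p) (c q)) z n ∧ z ∈ U) ∧
    z ≠ c p := (hev.and self_mem_nhdsWithin).exists
  obtain ⟨h1, h2⟩ := hU' z hzU hzp
  have hFn : HasLocalDegree F z n := hzn.congr (by
    filter_upwards [isOpen_ne.mem_nhds hzp] with w hw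
    exact Function.update_of_ne hw _ _)
  have hzt := mem_puncturedChart_target (P := P) hc h1
  have hconn : IsPreconnected c'.source := by
    rw [puncturedChart_source]
    exact (isPathConnected_source_punctured hc P).isConnected.isPreconnected
  have hF1 := hasLocalDegree_one_of_mem_homeoPlus (c := c') (x := c'.symm z) hf hconn
    (c'.map_target hzt) (by rw [puncturedChart_source]; exact h2)
  rw [c'.right_inv hzt] at hF1
  rwa [hFn.unique hF1] at hn

theorem continuousAt_chartQuotient (hc : c.target = univ) {p q x : S} (hq : q ∈ c.source)
    (h : x ≠ q) : ContinuousAt (chartQuotient c p q) x := by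
  have hs := continuous_symm_of_target_univ hc
  by_cases hx : x ∈ c.source
  · have h0 : c x - c q ≠ 0 := sub_ne_zero.mpr fun h' => h (c.injOn hx hq h')
    have h1 : ContinuousAt (fun y => 1 + (c q - c p) * (c y - c q)⁻¹) x :=
      continuousAt_const.add (continuousAt_const.mul
        (((c.continuousAt hx).sub continuousAt_const).inv₀ h0))
    refine h1.congr ?_
    filter_upwards [c.open_source.mem_nhds hx] with y hy
    rw [chartQuotient, if_pos hy]
  -- Points approaching the outside of the chart domain leave every compact set of the plane.
  · have hv : Tendsto (fun z : ℂ => 1 + (c q - c p) * (z - c q)⁻¹) (cocompact ℂ) (𝓝 1) := by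
      have h1 : Tendsto (fun z : ℂ => (z - c q)⁻¹) (cocompact ℂ) (𝓝 0) := by
        rw [← Metric.cobounded_eq_cocompact]
        have h2 := (Homeomorph.subRight (c q)).isClosedEmbedding.tendsto_cocompact
        rw [← Metric.cobounded_eq_cocompact] at h2
        exact tendsto_inv₀_cobounded.comp h2
      simpa using tendsto_const_nhds.add (h1.const_mul (c q - c p))
    have hval : chartQuotient c p q x = 1 := if_neg hx
    rw [ContinuousAt, hval]
    intro N hN
    obtain ⟨T, hT, hTN⟩ := mem_cocompact.mp (hv hN)
    have hC : IsClosed (c.symm '' T) := (hT.image hs).isClosed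
    have hxC : x ∉ c.symm '' T := by
      rintro ⟨z, -, rfl⟩
      exact hx (symm_mem_source_of_target_univ hc z)
    rw [mem_map]
    filter_upwards [hC.isOpen_compl.mem_nhds hxC] with y hy
    by_cases hys : y ∈ c.source
    · have h3 := hTN (show c y ∈ Tᶜ from fun h => hy ⟨c y, h, c.left_inv hys⟩)
      rw [mem_preimage, chartQuotient, if_pos hys]
      exact h3
    · rw [mem_preimage, chartQuotient, if_neg hys]
      exact mem_of_mem_nhds hN

/-- A homomorphism to `ℤ` that detects an orientation-preserving homeomorphism moving the puncture
`p` to another puncture: some class of loops about `p` is sent to `1`, its image to `-1`. -/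
theorem exists_windingHom [ChartedSpace ℂ S] [ConnectedSpace (Punctured S P)] {p q : S}
    (hp : p ∈ P) (hq : q ∈ P) (hpq : p ≠ q) {o : SurfaceOrientation (Punctured S P)}
    {f : Punctured S P ≃ₜ Punctured S P} (hf : f ∈ homeoPlus o)
    (hfpq : map f (punctureFilter P p) = punctureFilter P q) {x₀ : Punctured S P}
    (γ : FundamentalGroupoid.mk x₀ ⟶ FundamentalGroupoid.mk (f x₀)) :
    ∃ (φ : FundamentalGroup (Punctured S P) x₀ →* Multiplicative ℤ)
      (α : FundamentalGroup (Punctured S P) x₀),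
      φ α = .ofAdd 1 ∧ φ (pushAut f γ α) = .ofAdd (-1) := by
  obtain ⟨c, hc, hpc, hqc, -⟩ := exists_chart_of_pair P hp hpq
  let u : C(Punctured S P, ℂ) := ⟨fun x => chartQuotient c p q x, by
    rw [continuous_iff_continuousAt]
    intro x
    have hxq : (x : S) ≠ q := fun h => x.2 (h ▸ hq)
    exact (continuousAt_chartQuotient hc hqc hxq).comp continuous_subtype_val.continuousAt⟩
  have hu : ∀ x, u x ≠ 0 := fun x =>
    chartQuotient_ne_zero hpc hqc (fun h => x.2 (h ▸ hp)) (fun h => x.2 (h ▸ hq))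
  have huc : ∀ x : Punctured S P, (x : S) ∈ c.source → u x = (c x - c p) / (c x - c q) :=
    fun x hx => chartQuotient_of_mem hx hqc fun h => x.2 (h ▸ hq)
  obtain ⟨hdeg, hgood⟩ := hasLocalDegree_update hq hc hpc hqc hf hfpq
  set c' := puncturedChart P c
  set g := Function.update (fun z => c (f (c'.symm z))) (c p) (c q)
  have hgp : g (c p) = c q := Function.update_self _ _ _
  obtain ⟨R, hR, hgc, hgi, hgw⟩ := hdeg
  have hab : c p ≠ c q := fun h => hpq (c.injOn hpc hqc h)
  have hab' : 0 < ‖c q - c p‖ := norm_pos_iff.mpr (sub_ne_zero.mpr hab.symm)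
  have hgcont : ∀ᶠ z in 𝓝 (c p), ‖g z - c q‖ < ‖c q - c p‖ := by
    have h1 := (hgc.continuousAt (Metric.ball_mem_nhds _ hR)).tendsto
    rw [hgp] at h1
    have h2 := h1.eventually (Metric.ball_mem_nhds (c q) hab')
    filter_upwards [h2] with z hz
    exact mem_ball_iff_norm.mp hz
  obtain ⟨R', hR', hball⟩ := Metric.eventually_nhds_iff_ball.mp
    (hgcont.and (eventually_nhdsWithin_iff.mp hgood))
  -- Below `R` the degree is read off the circle; below `R'` the image circle stays in the chart,
  -- closer to `c q` than `c p` is; below `‖c q - c p‖` the circle does not enclose `c q`.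
  obtain ⟨r, hr0, hr⟩ := exists_between (show 0 < min R (min R' ‖c q - c p‖) by positivity)
  have hrR : r < R := hr.trans_le (min_le_left _ _)
  have hrR' : r < R' := hr.trans_le ((min_le_right _ _).trans (min_le_left _ _))
  have hrab : r < ‖c q - c p‖ := hr.trans_le ((min_le_right _ _).trans (min_le_right _ _))
  have hdist : ∀ t, ‖circleMap (c p) r t - c p‖ = r := fun t => by
    simp [circleMap_sub_center, abs_of_pos hr0]
  have hcne : ∀ t, circleMap (c p) r t ≠ c p := fun t => circleMap_ne_center hr0.ne'
  have hcirc : ∀ t, circleMap (c p) r t ∈ Metric.ball (c p) R' := fun t => by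
    rw [mem_ball_iff_norm, hdist]
    exact hrR'
  have hP : ∀ t, c.symm (circleMap (c p) r t) ∉ P := fun t => ((hball _ (hcirc t)).2 (hcne t)).1
  have hfs : ∀ t, (f (c'.symm (circleMap (c p) r t)) : S) ∈ c.source :=
    fun t => ((hball _ (hcirc t)).2 (hcne t)).2
  have hgt : ∀ t, g (circleMap (c p) r t) = c (f (c'.symm (circleMap (c p) r t))) :=
    fun t => Function.update_of_ne (hcne t) _ _
  have hper : ∀ t, circleMap (c p) r (t + 2 * Real.pi) = circleMap (c p) r t :=
    periodic_circleMap (c p) r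
  have hcoe : ∀ t, (c'.symm (circleMap (c p) r t) : S) = c.symm (circleMap (c p) r t) :=
    fun t => coe_puncturedChart_symm (hP t)
  let ℓ : ℝ → Punctured S P := fun t => c'.symm (circleMap (c p) r t)
  have hℓ : Continuous ℓ := c'.continuousOn_symm.comp_continuous (continuous_circleMap _ _)
    fun t => mem_puncturedChart_target hc (hP t)
  have hℓ1 : ℓ (2 * Real.pi) = ℓ 0 := by
    have := hper 0
    rw [zero_add] at this
    simp only [ℓ, this]
  have hℓs : ∀ t, (ℓ t : S) ∈ c.source := fun t => by
    change (c'.symm (circleMap (c p) r t) : S) ∈ c.source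
    rw [hcoe]
    exact symm_mem_source_of_target_univ hc _
  have hℓc : ∀ t, c (ℓ t) = circleMap (c p) r t := fun t => by
    change c (c'.symm (circleMap (c p) r t) : S) = _
    rw [hcoe, right_inv_of_target_univ hc]
  have hw1 : HasWinding (fun t => u (ℓ t)) 1 := by
    have h1 : HasWinding (fun t => circleMap (c p) r t - c q) 0 := by
      refine hasWinding_zero_of_norm_sub_lt (w := c p - c q)
        ((continuous_circleMap _ _).sub continuous_const) (fun t => by rw [hper]) fun t => ?_
      rw [sub_sub_sub_cancel_right, hdist, norm_sub_rev]
      exact hrab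
    have h2 := (hasWinding_circleMap (c p) hr0).div h1
    have h3 : (fun t => u (ℓ t)) =
        fun t => (circleMap (c p) r t - c p) / (circleMap (c p) r t - c q) := by
      ext t
      rw [huc _ (hℓs t), hℓc]
    rw [h3]
    simpa using h2
  -- The image circle does not wind about `c p`, and winds once about `c q`, which is in the
  -- denominator.
  have hw2 : HasWinding (fun t => u (f (ℓ t))) (-1) := by
    have hgℓ : ∀ t, g (circleMap (c p) r t) = c (f (ℓ t)) := hgt
    have h1 : HasWinding (fun t => g (circleMap (c p) r t) - c p) 0 := by
      refine hasWinding_zero_of_norm_sub_lt (w := c q - c p) ?_ (fun t => by rw [hper]) fun t => ?_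
      · refine (hgc.comp_continuous (continuous_circleMap _ _) fun t => ?_).sub continuous_const
        rw [mem_ball_iff_norm, hdist]
        exact hrR
      · rw [sub_sub_sub_cancel_right]
        exact (hball _ (hcirc t)).1
    have h2 := h1.div (hgw r hr0 hrR)
    have h3 : (fun t => u (f (ℓ t))) = fun t =>
        (g (circleMap (c p) r t) - c p) / (g (circleMap (c p) r t) - g (c p)) := by
      ext t
      rw [huc _ (hfs t), hgp, hgℓ]
    rw [h3]
    simpa using h2
  let ρ : Path (ℓ 0) (ℓ 0) :=
    { toFun := fun t => ℓ (2 * Real.pi * t)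
      continuous_toFun := by fun_prop
      source' := by simp
      target' := by simp [hℓ1] }
  let β : FundamentalGroupoid.mk x₀ ⟶ FundamentalGroupoid.mk (ℓ 0) :=
    FundamentalGroupoid.fromPath (.mk (PathConnectedSpace.somePath x₀ (ℓ 0)))
  let ρ' : FundamentalGroupoid.mk (ℓ 0) ⟶ FundamentalGroupoid.mk (ℓ 0) :=
    FundamentalGroupoid.fromPath (.mk ρ)
  let α : FundamentalGroup (Punctured S P) x₀ := β ≫ ρ' ≫ Groupoid.inv β
  refine ⟨windingHom hu x₀, α, windingHom_eq hu ?_, windingHom_eq hu ?_⟩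
  · rw [logIncrementHom_conj, logIncrementHom_mk]
    exact logIncrement_eq_of_hasWinding hu ρ hw1 fun t => rfl
  · rw [pushAut_apply]
    let Φ := FundamentalGroupoid.map (f : C(Punctured S P, Punctured S P))
    have h1 : Φ.map α = Φ.map β ≫ Φ.map ρ' ≫ Groupoid.inv (Φ.map β) := by
      simp [α]
    have h2 := logIncrementHom_conj hu γ (Φ.map α)
    refine h2.trans ?_
    rw [h1]
    refine (logIncrementHom_conj hu (Φ.map β) (Φ.map ρ')).trans ?_
    exact logIncrement_eq_of_hasWinding hu (ρ.map f.continuous) hw2 fun t => rfl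

end Puncture

end

/-! ### The congruence property, from homomorphisms modulo 3 -/

theorem mainTheorem4 {S : Type*} [TopologicalSpace S] [T2Space S] [CompactSpace S]
    [ChartedSpace ℂ S] (P : Finset S) [ConnectedSpace (Punctured S P)]
    (o : SurfaceOrientation (Punctured S P)) (x₀ : Punctured S P)
    (hyperbolic : eulerCharPunctured P (x₀ : S) < 0) :
    IsCongruenceSubgroup (outerAction o x₀) (pureMappingClassGroup P o) := by
  let G := FundamentalGroup (Punctured S P) x₀
  -- The modulus must separate `1` from `-1`, so 2 would not do.
  let A := Multiplicative (ZMod 3)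
  have hchar := commonKernel_characteristic G A
  refine ⟨commonKernel G A, hchar,
    commonKernel_finiteIndex G A (fundamentalGroup_punctured_fg P x₀), fun m hm => ?_⟩
  obtain ⟨f, rfl⟩ := QuotientGroup.mk_surjective m
  refine ⟨f, fun p hp => ?_, rfl⟩
  obtain ⟨q, hq, hfpq⟩ := exists_map_punctureFilter_eq (f : Punctured S P ≃ₜ Punctured S P) hp
  by_cases hpq : p = q
  · rw [hfpq, hpq]
  exfalso
  let γ := FundamentalGroupoid.fromPath (.mk (PathConnectedSpace.somePath x₀
    ((f : Punctured S P ≃ₜ Punctured S P) x₀)))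
  obtain ⟨φ, α, h1, h2⟩ := exists_windingHom hp hq hpq f.2 hfpq γ
  have h3 : outQuotient (commonKernel G A) (QuotientGroup.mk (pushAut f.1 γ)) = 1 := hm
  have h4 := map_eq_of_outQuotient_eq_one le_rfl h3
    ((AddMonoidHom.toMultiplicative (Int.castAddHom (ZMod 3))).comp φ) α
  simp only [MonoidHom.comp_apply, h1, h2] at h4
  have h5 : ((-1 : ℤ) : ZMod 3) = ((1 : ℤ) : ZMod 3) := h4
  exact absurd h5 (by decide)
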